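/- Let $\mathbb F_q$ be a finite field with $q$ elements, let $[[n]]=\{(i,j):1\le i<j\le n\}$, and let $\mathcal P\subset[[n]]$ be a poset (i.e. $(i,j),(j,k)\in\mathcal P$ implies $(i,k)\in\mathcal P$) which is normal in $[[n]]$: $(j,k)\in\mathcal P$ implies $(i,l)\in\mathcal P$ whenever $1\le i\le j<k\le l\le n$. Let $\mathfrak n_{\mathcal P}$ be the algebra of $n\times n$ matrices over $\mathbb F_q$ whose nonzero entries lie in positions of $\mathcal P$, let $U_{\mathcal P}=1+\mathfrak n_{\mathcal P}$, and let $\mathfrak n_{\mathcal P}^*$ be the dual space of $\mathfrak n_{\mathcal P}$. For $\lambda\in\mathfrak n_{\mathcal P}^*$ put $\lambda_{ij}=\lambda(e_{ij})$ if $(i,j)\in\mathcal P$ and $\lambda_{ij}=0$ otherwise, where $e_{ij}$ is the elementary matrix, and $\mathrm{supp}(\lambda)=\{(i,j)\in\mathcal P:\lambda_{ij}\ne0\}$. The group $U_{\mathcal P}$ acts on $\mathfrak n_{\mathcal P}^*$ by $g\lambda(X)=\lambda(g^{-1}X)$ and $\lambda g(X)=\lambda(Xg^{-1})$. Fix a nontrivial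 homomorphism $\theta:\mathbb F_q^+\to\mathbb C^\times$. The supercharacters of $U_{\mathcal P}$ are the functions $$\chi^\lambda_{\mathcal P}(g)=\frac{|U_{\mathcal P}\lambda|}{|U_{\mathcal P}\lambda U_{\mathcal P}|}\sum_{\mu\in U_{\mathcal P}\lambda U_{\mathcal P}}\theta(\mu(g-1)),\qquad g\in U_{\mathcal P},\ \lambda\in\mathfrak n_{\mathcal P}^*.$$ Let $\mathscr S_{\mathcal P}^*$ (the $\mathbb F_q$-labeled set partitions) be the set of $\lambda\in\mathfrak n_{\mathcal P}^*$ such that $\mathrm{supp}(\lambda)$ contains at most one position in each row and in each column. For $\lambda\in\mathscr S_{\mathcal P}^*$ and $\mathcal Q\in\{\mathcal P,[[n]]\}$ let $$\mathrm{coadj}^L_{\mathcal Q}(\lambda)=\{(j,k)\in\mathcal P:\exists\,(i,k)\in\mathrm{supp}(\lambda),\ (i,j)\in\mathcal Q\},\qquad \mathrm{coadj}^R_{\mathcal Q}(\lambda)=\{(i,j)\in\mathcal P:\exists\,(i,k)\in\mathrm{supp}(\lambda),\ (j,k)\in\mathcal Q\},$$ $\mathrm{coadj}_{\mathcal Q}(\lambda)=\mathrm{coadj}^L_{\mathcal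 Q}(\lambda)\cup\mathrm{coadj}^R_{\mathcal Q}(\lambda)$, and $$\mathrm{coaux}^{L}_{\mathcal P}(\lambda)=\mathrm{coadj}^{L}_{[[n]]}(\lambda)\setminus\mathrm{coadj}^{L}_{\mathcal P}(\lambda),\quad \mathrm{coaux}^{R}_{\mathcal P}(\lambda)=\mathrm{coadj}^{R}_{[[n]]}(\lambda)\setminus\mathrm{coadj}^{R}_{\mathcal P}(\lambda),\quad \mathrm{coaux}_{\mathcal P}(\lambda)=\mathrm{coadj}_{[[n]]}(\lambda)\setminus\mathrm{coadj}_{\mathcal P}(\lambda).$$ For $\eta,\mu\in\mathfrak n_{\mathcal P}^*$ define $\eta*_\lambda\mu\in\mathfrak n_{\mathcal P}^*$ by $$(\eta*_\lambda\mu)_{jk}=\eta_{jk}+\mu_{jk}+\sum_{i<j<k<l,\ (i,l)\in\mathrm{supp}(\lambda)}\eta_{jl}\,\mu_{ik}\,\lambda_{il}^{-1},\qquad (j,k)\in\mathcal P.$$ For $\eta\in\mathfrak n_{\mathcal P}^*$ with $\mathrm{supp}(\eta)\subset\mathrm{coaux}_{\mathcal P}(\lambda)$, write $\eta=\eta_L+\eta_{R\setminus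 L}$ with $\mathrm{supp}(\eta_L)\subset\mathrm{coaux}^L_{\mathcal P}(\lambda)$ and $\mathrm{supp}(\eta_{R\setminus L})\subset\mathrm{coaux}^R_{\mathcal P}(\lambda)\setminus\mathrm{coaux}^L_{\mathcal P}(\lambda)$ (such a decomposition exists and is unique), put $\mathfrak R^*_\lambda(\eta)=\eta_L*_\lambda\eta_{R\setminus L}$, and let $$\chi^{(\lambda,\eta)}_{\mathcal P}=\chi^{\lambda+\mathfrak R^*_\lambda(\eta)}_{\mathcal P}.$$ Theorem. (a) The map $(\lambda,\eta)\mapsto\chi^{(\lambda,\eta)}_{\mathcal P}$ is a bijection from the set of pairs $(\lambda,\eta)$ with $\lambda\in\mathscr S^*_{\mathcal P}$, $\eta\in\mathfrak n^*_{\mathcal P}$ and $\mathrm{supp}(\eta)\subset\mathrm{coaux}_{\mathcal P}(\lambda)$ onto the set of supercharacters of $U_{\mathcal P}$. (b) For every such pair, $$\chi^{(\lambda,\eta)}_{\mathcal P}(1)=q^{|\mathrm{coadj}^L_{\mathcal P}(\lambda)|}=q^{|\mathrm{coadj}^R_{\mathcal P}(\lambda)|},\qquad \bigl\langle\chi^{(\lambda,\eta)}_{\mathcal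 P},\chi^{(\lambda,\eta)}_{\mathcal P}\bigr\rangle_{U_{\mathcal P}}=q^{|\mathrm{coadj}^L_{\mathcal P}(\lambda)\cap\mathrm{coadj}^R_{\mathcal P}(\lambda)|},$$ where $\langle\chi,\psi\rangle_{U_{\mathcal P}}=\frac1{|U_{\mathcal P}|}\sum_{g\in U_{\mathcal P}}\chi(g)\overline{\psi(g)}$. -/

import Mathlib

/-- A poset on `[n]`: a set of positions strictly above the diagonal which is transitive. -/
structure PosPoset (n : ℕ) where
  carrier : Set (Fin n × Fin n)
  lt_of_mem : ∀ {i j : Fin n}, (i, j) ∈ carrier → i < j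
  trans : ∀ {i j k : Fin n}, (i, j) ∈ carrier → (j, k) ∈ carrier → (i, k) ∈ carrier

namespace PosPoset

/-- The poset `[[n]]` of all positions strictly above the diagonal. -/
def full (n : ℕ) : PosPoset n where
  carrier := {p | p.1 < p.2}
  lt_of_mem := fun h => h
  trans := fun {i j k} h₁ h₂ => lt_trans (show i < j from h₁) (show j < k from h₂)

/-- Normality of `P` in `[[n]]`. -/
def IsNormal {n : ℕ} (P : PosPoset n) : Prop :=
  ∀ i j k l : Fin n, i ≤ j → j < k → k ≤ l → (i, l) ∉ P.carrier → (j, k) ∉ P.carrier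

end PosPoset

/-- The algebra `𝔫_P` of matrices supported on `P`. -/
def patternAlgebra (F : Type*) [Field F] {n : ℕ} (P : PosPoset n) :
    Submodule F (Matrix (Fin n) (Fin n) F) where
  carrier := {X | ∀ i j, X i j ≠ 0 → (i, j) ∈ P.carrier}
  zero_mem' := fun i j h => absurd rfl h
  add_mem' := by
    intro X Y hX hY i j h
    by_contra hij
    have h₁ : X i j = 0 := by
      by_contra hx
      exact hij (hX i j hx)
    have h₂ : Y i j = 0 := by
      by_contra hy
      exact hij (hY i j hy)
    exact h (by simp [h₁, h₂])
  smul_mem' := by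
    intro c X hX i j h
    refine hX i j fun hx => h ?_
    simp [hx]

theorem patternAlgebra_apply_eq_zero {F : Type*} [Field F] {n : ℕ} {P : PosPoset n}
    {X : Matrix (Fin n) (Fin n) F} (hX : X ∈ patternAlgebra F P) {i j : Fin n}
    (h : (i, j) ∉ P.carrier) : X i j = 0 := by
  by_contra hx
  exact h (hX i j hx)

/-- `𝔫_P` is closed under multiplication. -/
theorem patternAlgebra_mul_mem {F : Type*} [Field F] {n : ℕ} {P : PosPoset n}
    {X Y : Matrix (Fin n) (Fin n) F} (hX : X ∈ patternAlgebra F P)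
    (hY : Y ∈ patternAlgebra F P) : X * Y ∈ patternAlgebra F P := by
  intro i k h
  rw [Matrix.mul_apply] at h
  obtain ⟨j, -, hj⟩ := Finset.exists_ne_zero_of_sum_ne_zero h
  exact P.trans (hX i j (left_ne_zero_of_mul hj)) (hY j k (right_ne_zero_of_mul hj))

/-- The entries of an element of `U_P`: ones on the diagonal, zeros below the diagonal, and zeros
at the positions above the diagonal that are not in `P`. -/
def IsPatternUnipotent {F : Type*} [Field F] {n : ℕ} (P : PosPoset n)
    (g : Matrix (Fin n) (Fin n) F) : Prop :=
  (∀ i, g i i = 1) ∧ (∀ i j, j < i → g i j = 0) ∧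
    ∀ i j, i < j → (i, j) ∉ P.carrier → g i j = 0

theorem isPatternUnipotent_iff {F : Type*} [Field F] {n : ℕ} {P : PosPoset n}
    {g : Matrix (Fin n) (Fin n) F} :
    IsPatternUnipotent P g ↔ g - 1 ∈ patternAlgebra F P := by
  constructor
  · rintro ⟨h₁, h₂, h₃⟩ i j h
    by_contra hij
    apply h
    rcases lt_trichotomy i j with hlt | rfl | hlt
    · simp [h₃ i j hlt hij, Matrix.one_apply_ne hlt.ne]
    · simp [h₁]
    · simp [h₂ i j hlt, Matrix.one_apply_ne hlt.ne']
  · intro h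
    refine ⟨fun i => ?_, fun i j hij => ?_, fun i j hij hP => ?_⟩
    · have := patternAlgebra_apply_eq_zero h (fun hi => lt_irrefl i (P.lt_of_mem hi))
      simpa [sub_eq_zero] using this
    · have := patternAlgebra_apply_eq_zero h (fun hi => lt_asymm hij (P.lt_of_mem hi))
      simpa [Matrix.one_apply_ne hij.ne'] using this
    · have := patternAlgebra_apply_eq_zero h hP
      simpa [Matrix.one_apply_ne hij.ne] using this

/-- The pattern group `U_P`. -/
def patternGroup (F : Type*) [Field F] [Finite F] {n : ℕ} (P : PosPoset n) :
    Subgroup (Matrix (Fin n) (Fin n) F)ˣ :=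
  let M : Submonoid (Matrix (Fin n) (Fin n) F)ˣ :=
    { carrier := {g | IsPatternUnipotent P (g : Matrix (Fin n) (Fin n) F)}
      one_mem' := by
        show IsPatternUnipotent P _
        rw [isPatternUnipotent_iff]
        simp
      mul_mem' := by
        intro g h hg hh
        have hg' := isPatternUnipotent_iff.1 hg
        have hh' := isPatternUnipotent_iff.1 hh
        refine isPatternUnipotent_iff.2 ?_
        have e : ((g * h : (Matrix (Fin n) (Fin n) F)ˣ) : Matrix (Fin n) (Fin n) F) - 1
            = (g - 1 : Matrix (Fin n) (Fin n) F) * (h - 1) + (g - 1) + (h - 1) := by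
          rw [Units.val_mul]
          noncomm_ring
        rw [e]
        exact add_mem (add_mem (patternAlgebra_mul_mem hg' hh') hg') hh' }
  { M with
    inv_mem' := by
      intro g hg
      have e : g⁻¹ = g ^ (orderOf g - 1) := by
        apply inv_eq_of_mul_eq_one_left
        rw [← pow_succ, Nat.sub_add_cancel (orderOf_pos g), pow_orderOf_eq_one]
      rw [e]
      exact M.pow_mem (show g ∈ M from hg) _ }

theorem mem_patternGroup {F : Type*} [Field F] [Finite F] {n : ℕ} {P : PosPoset n}
    {g : (Matrix (Fin n) (Fin n) F)ˣ} :
    g ∈ patternGroup F P ↔ IsPatternUnipotent P (g : Matrix (Fin n) (Fin n) F) :=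
  Iff.rfl

section Supercharacters

variable {F : Type*} [Field F] [Finite F] {n : ℕ} {P : PosPoset n}

/-- The underlying matrix of an element of `U_P`. -/
def patternMatrix (g : patternGroup F P) : Matrix (Fin n) (Fin n) F :=
  ((g : (Matrix (Fin n) (Fin n) F)ˣ) : Matrix (Fin n) (Fin n) F)

/-- The element `g - 1` of `𝔫_P` for `g ∈ U_P`. -/
def patternSubOne (g : patternGroup F P) : patternAlgebra F P :=
  ⟨patternMatrix g - 1, isPatternUnipotent_iff.1 g.2⟩

/-- Left multiplication `X ↦ g X` of `U_P` on `𝔫_P`. -/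
def patternLeftMul (g : patternGroup F P) : patternAlgebra F P →ₗ[F] patternAlgebra F P where
  toFun X := ⟨patternMatrix g * (X : Matrix (Fin n) (Fin n) F), by
    have e : patternMatrix g * (X : Matrix (Fin n) (Fin n) F)
        = (patternMatrix g - 1) * (X : Matrix (Fin n) (Fin n) F) + X := by noncomm_ring
    rw [e]
    exact add_mem (patternAlgebra_mul_mem (patternSubOne g).2 X.2) X.2⟩
  map_add' X Y := Subtype.ext (by simp [mul_add])
  map_smul' c X := Subtype.ext (by simp)

/-- Right multiplication `X ↦ X g` of `U_P` on `𝔫_P`. -/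
def patternRightMul (g : patternGroup F P) : patternAlgebra F P →ₗ[F] patternAlgebra F P where
  toFun X := ⟨(X : Matrix (Fin n) (Fin n) F) * patternMatrix g, by
    have e : (X : Matrix (Fin n) (Fin n) F) * patternMatrix g
        = (X : Matrix (Fin n) (Fin n) F) * (patternMatrix g - 1) + X := by noncomm_ring
    rw [e]
    exact add_mem (patternAlgebra_mul_mem X.2 (patternSubOne g).2) X.2⟩
  map_add' X Y := Subtype.ext (by simp [add_mul])
  map_smul' c X := Subtype.ext (by simp)

/-- `(g • lam)(X) = lam (g⁻¹ X)`. -/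
def coLeft (g : patternGroup F P) (lam : Module.Dual F (patternAlgebra F P)) :
    Module.Dual F (patternAlgebra F P) :=
  lam ∘ₗ patternLeftMul g⁻¹

/-- `(lam • g)(X) = lam (X g⁻¹)`. -/
def coRight (lam : Module.Dual F (patternAlgebra F P)) (g : patternGroup F P) :
    Module.Dual F (patternAlgebra F P) :=
  lam ∘ₗ patternRightMul g⁻¹

/-- The left orbit `U_P lam`. -/
def leftCoorbit (lam : Module.Dual F (patternAlgebra F P)) :
    Set (Module.Dual F (patternAlgebra F P)) :=
  {mu | ∃ g : patternGroup F P, mu = coLeft g lam}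

/-- The two-sided orbit `U_P lam U_P`. -/
def twoSidedCoorbit (lam : Module.Dual F (patternAlgebra F P)) :
    Set (Module.Dual F (patternAlgebra F P)) :=
  {mu | ∃ g h : patternGroup F P, mu = coRight (coLeft g lam) h}

instance instFinitePatternDual : Finite (Module.Dual F (patternAlgebra F P)) :=
  Module.finite_of_finite F

noncomputable instance instFintypePatternGroup : Fintype (patternGroup F P) :=
  Fintype.ofFinite _

/-- The supercharacter `χ_P^lam` of `U_P`, for a fixed character `θ` of the additive group of
`F`. -/
noncomputable def superchar (θ : AddChar F ℂ) (lam : Module.Dual F (patternAlgebra F P)) :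
    patternGroup F P → ℂ :=
  fun g => ((leftCoorbit lam).ncard : ℂ) / ((twoSidedCoorbit lam).ncard : ℂ) *
    ∑ mu ∈ (Set.toFinite (twoSidedCoorbit lam)).toFinset, θ (mu (patternSubOne g))

/-- The set of supercharacters of `U_P`. -/
def supercharacters (θ : AddChar F ℂ) (P : PosPoset n) : Set (patternGroup F P → ℂ) :=
  {χ | ∃ lam : Module.Dual F (patternAlgebra F P), χ = superchar θ lam}

/-- The inner product of complex functions on `U_P`. -/
noncomputable def patternInner (χ ψ : patternGroup F P → ℂ) : ℂ :=
  (1 / (Nat.card (patternGroup F P) : ℂ)) * ∑ g, χ g * (starRingEnd ℂ) (ψ g)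

end Supercharacters

section Coordinates

variable {F : Type*} [Field F] {n : ℕ} {P : PosPoset n}

open Classical in
/-- The `(i, j)` entry of a functional: `lam e_{ij}` if `(i, j) ∈ P`, and `0` otherwise. -/
noncomputable def coEntry (lam : Module.Dual F (patternAlgebra F P)) (i j : Fin n) : F :=
  if h : (i, j) ∈ P.carrier then
    lam ⟨Matrix.single i j 1, by
      intro a b hab
      by_cases hc : i = a ∧ j = b
      · obtain ⟨rfl, rfl⟩ := hc
        exact h
      · exact absurd (Matrix.single_apply_of_ne i j 1 a b hc) hab⟩
  else 0

/-- The functional on `𝔫_P` with prescribed entries `a i j` at the positions `(i, j) ∈ P` (the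
values of `a` at the other positions play no role). -/
def ofCoEntries (P : PosPoset n) (a : Fin n → Fin n → F) : Module.Dual F (patternAlgebra F P) where
  toFun X := ∑ i, ∑ j, a i j * (X : Matrix (Fin n) (Fin n) F) i j
  map_add' X Y := by simp [mul_add, Finset.sum_add_distrib]
  map_smul' c X := by simp [Finset.mul_sum, mul_left_comm]

theorem coEntry_ofCoEntries (a : Fin n → Fin n → F) {i j : Fin n} (h : (i, j) ∈ P.carrier) :
    coEntry (ofCoEntries P a) i j = a i j := by
  simp only [coEntry, h, dif_pos, ofCoEntries, LinearMap.coe_mk, AddHom.coe_mk]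
  rw [Finset.sum_eq_single i, Finset.sum_eq_single j]
  · simp
  · intro b _ hb
    simp [Matrix.single_apply_of_ne i j (1 : F) i b (fun hc => hb hc.2.symm)]
  · simp
  · intro b _ hb
    refine Finset.sum_eq_zero fun c _ => ?_
    simp [Matrix.single_apply_of_ne i j (1 : F) b c (fun hc => hb hc.1.symm)]
  · simp

/-- The support of a functional. -/
def coSupp (lam : Module.Dual F (patternAlgebra F P)) : Set (Fin n × Fin n) :=
  {p | p ∈ P.carrier ∧ coEntry lam p.1 p.2 ≠ 0}

/-- The set `𝒮_P^*` of labeled set partitions, as functionals: the support has at most one position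
in each row and in each column. -/
def coSetPartitions (F : Type*) [Field F] {n : ℕ} (P : PosPoset n) :
    Set (Module.Dual F (patternAlgebra F P)) :=
  {lam | ∀ p ∈ coSupp lam, ∀ r ∈ coSupp lam, (p.1 = r.1 ∨ p.2 = r.2) → p = r}

/-- `coadj^L_Q(lam)`. -/
def coadjL (Q : PosPoset n) (lam : Module.Dual F (patternAlgebra F P)) : Set (Fin n × Fin n) :=
  {p | p ∈ P.carrier ∧ ∃ i, (i, p.2) ∈ coSupp lam ∧ (i, p.1) ∈ Q.carrier}

/-- `coadj^R_Q(lam)`. -/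
def coadjR (Q : PosPoset n) (lam : Module.Dual F (patternAlgebra F P)) : Set (Fin n × Fin n) :=
  {p | p ∈ P.carrier ∧ ∃ k, (p.1, k) ∈ coSupp lam ∧ (p.2, k) ∈ Q.carrier}

/-- `coadj_Q(lam)`. -/
def coadj (Q : PosPoset n) (lam : Module.Dual F (patternAlgebra F P)) : Set (Fin n × Fin n) :=
  coadjL Q lam ∪ coadjR Q lam

/-- `coaux^L_Q(lam)`. -/
def coauxL (Q : PosPoset n) (lam : Module.Dual F (patternAlgebra F P)) : Set (Fin n × Fin n) :=
  coadjL (PosPoset.full n) lam \ coadjL Q lam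

/-- `coaux^R_Q(lam)`. -/
def coauxR (Q : PosPoset n) (lam : Module.Dual F (patternAlgebra F P)) : Set (Fin n × Fin n) :=
  coadjR (PosPoset.full n) lam \ coadjR Q lam

/-- `coaux_Q(lam)`. -/
def coaux (Q : PosPoset n) (lam : Module.Dual F (patternAlgebra F P)) : Set (Fin n × Fin n) :=
  coadj (PosPoset.full n) lam \ coadj Q lam

open Classical in
/-- The functional which agrees with `η` at the positions in `S` and has entry `0` elsewhere. -/
noncomputable def coRestrict (S : Set (Fin n × Fin n)) (η : Module.Dual F (patternAlgebra F P)) :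
    Module.Dual F (patternAlgebra F P) :=
  ofCoEntries P fun i j => if (i, j) ∈ S then coEntry η i j else 0

open Classical in
/-- The product `η *_lam μ` on `𝔫_P^*`, whose `(j, k)` entry for `(j, k) ∈ P` is
`η_{jk} + μ_{jk} + ∑ η_{jl} μ_{ik} lam_{il}⁻¹`, the sum over `i < j < k < l` with
`(i, l) ∈ supp lam`. -/
noncomputable def coStar (lam η μ : Module.Dual F (patternAlgebra F P)) :
    Module.Dual F (patternAlgebra F P) :=
  ofCoEntries P fun j k => coEntry η j k + coEntry μ j k +
    ∑ p : Fin n × Fin n with p.1 < j ∧ j < k ∧ k < p.2 ∧ p ∈ coSupp lam,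
      coEntry η j p.2 * coEntry μ p.1 k * (coEntry lam p.1 p.2)⁻¹

/-- `ℜ^*_lam(η) = η_L *_lam η_{R \ L}`, where `η_L` and `η_{R \ L}` are the parts of `η` supported
on `coaux^L_P(lam)` and on `coaux^R_P(lam) - coaux^L_P(lam)`. -/
noncomputable def coRep (lam η : Module.Dual F (patternAlgebra F P)) :
    Module.Dual F (patternAlgebra F P) :=
  coStar lam (coRestrict (coauxL P lam) η) (coRestrict (coauxR P lam \ coauxL P lam) η)

end Coordinates

/-- The supercharacter `χ_P^{(lam, η)}`, indexed by `lam + ℜ^*_lam(η)`. -/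
noncomputable def pairSuperchar {F : Type*} [Field F] [Finite F] {n : ℕ} {P : PosPoset n}
    (θ : AddChar F ℂ) (lam η : Module.Dual F (patternAlgebra F P)) : patternGroup F P → ℂ :=
  superchar θ (lam + coRep lam η)

/-! ### Functionals and their entries -/

section Entries

variable {F : Type*} [Field F] {n : ℕ} {P : PosPoset n}

/-! Record a functional by its matrix of entries. The two actions of `U_P` become left and right
multiplication by lower unitriangular matrices of transposed pattern `P`, followed by truncation to
`P`. Normality of `P` is used twice: truncation is compatible with multiplication by every lower
unitriangular matrix, so the full unitriangular group acts as well (`biact_biact`), and that group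
normalizes the `P`-pattern matrices (`conj_mem_lowerPattern`). Hence a two-sided orbit of the full
group splits into two-sided `P`-orbits that are translates of one another and have equal size.

Gaussian elimination puts a labeled set partition `lam` in each full orbit, and only one fits. For
such `lam` the one-sided orbits are affine: `lam` plus all functionals supported on `coadjL`,
respectively `coadjR`. Double counting gives |left orbit| · |right orbit| = |two-sided orbit| ·
|intersection|, so the two-sided orbit has `q ^ |coadj|` elements, both for `P` and for the full
group.

The product `*_lam` is designed so that `lam + coRep lam η` is `A lam B`, where `A lam = lam + η_L`
and `lam B = lam + η_{R \ L}` (`biact_eq_add_coStar`). So its `P`-orbit has the size of that of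
`lam`. Different `η` give disjoint `P`-orbits (`eq_of_add_coRep_mem_biorbit`). There are `q ^
|coaux|` of them, of size `q ^ |coadj_P|` each, which adds up to the full orbit; they therefore
exhaust it, and no explicit reduction to a representative is needed.

Finally, the functions `g ↦ θ (mu (g - 1))` are orthonormal, so supercharacters correspond to
two-sided `P`-orbits. The degree is |left orbit| and the norm is |left orbit|² / |two-sided orbit|;
since |coadjL| = |coadjR|, the exponent 2|L| - |L ∪ R| equals |L ∩ R|. -/

theorem coEntry_of_notMem (lam : Module.Dual F (patternAlgebra F P)) {i j : Fin n}
    (h : (i, j) ∉ P.carrier) : coEntry lam i j = 0 := by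
  simp [coEntry, h]

theorem mem_of_coEntry_ne_zero {lam : Module.Dual F (patternAlgebra F P)} {i j : Fin n}
    (h : coEntry lam i j ≠ 0) : (i, j) ∈ P.carrier := by
  by_contra hij
  exact h (coEntry_of_notMem lam hij)

theorem mem_coSupp {lam : Module.Dual F (patternAlgebra F P)} {i j : Fin n} :
    (i, j) ∈ coSupp lam ↔ coEntry lam i j ≠ 0 :=
  ⟨fun h => h.2, fun h => ⟨mem_of_coEntry_ne_zero h, h⟩⟩

theorem notMem_coSupp {lam : Module.Dual F (patternAlgebra F P)} {i j : Fin n} :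
    (i, j) ∉ coSupp lam ↔ coEntry lam i j = 0 := by
  rw [mem_coSupp, not_not]

theorem coEntry_add (lam mu : Module.Dual F (patternAlgebra F P)) (i j : Fin n) :
    coEntry (lam + mu) i j = coEntry lam i j + coEntry mu i j := by
  unfold coEntry
  split_ifs <;> simp

theorem coEntry_sub (lam mu : Module.Dual F (patternAlgebra F P)) (i j : Fin n) :
    coEntry (lam - mu) i j = coEntry lam i j - coEntry mu i j := by
  unfold coEntry
  split_ifs <;> simp

/-- A functional is recovered from its entries. -/
theorem ofCoEntries_coEntry (lam : Module.Dual F (patternAlgebra F P)) :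
    ofCoEntries P (coEntry lam) = lam := by
  classical
  refine LinearMap.ext fun X => ?_
  let E : Fin n → Fin n → patternAlgebra F P := fun i j =>
    if h : (i, j) ∈ P.carrier then ⟨Matrix.single i j 1, by
      intro a b hab
      by_cases hc : i = a ∧ j = b
      · obtain ⟨rfl, rfl⟩ := hc
        exact h
      · exact absurd (Matrix.single_apply_of_ne i j 1 a b hc) hab⟩ else 0
  have hE : ∀ i j, lam (E i j) = coEntry lam i j := fun i j => by
    simp only [E, coEntry]
    split_ifs <;> simp
  have hX : X = ∑ i, ∑ j, (X : Matrix (Fin n) (Fin n) F) i j • E i j := by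
    refine Subtype.ext ?_
    conv_lhs => rw [Matrix.matrix_eq_sum_single (X : Matrix (Fin n) (Fin n) F)]
    simp only [AddSubmonoidClass.coe_finsetSum]
    refine Finset.sum_congr rfl fun i _ => Finset.sum_congr rfl fun j _ => ?_
    by_cases h : (i, j) ∈ P.carrier
    · simp [E, h]
    · simp [E, h, patternAlgebra_apply_eq_zero X.2 h]
  conv_rhs => rw [hX]
  simp only [map_sum, map_smul, hE, smul_eq_mul]
  simp only [ofCoEntries, LinearMap.coe_mk, AddHom.coe_mk]
  exact Finset.sum_congr rfl fun i _ => Finset.sum_congr rfl fun j _ => mul_comm _ _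

theorem dual_apply (lam : Module.Dual F (patternAlgebra F P)) (X : patternAlgebra F P) :
    lam X = ∑ i, ∑ j, coEntry lam i j * (X : Matrix (Fin n) (Fin n) F) i j := by
  conv_lhs => rw [← ofCoEntries_coEntry lam]
  rfl

theorem dual_ext {lam mu : Module.Dual F (patternAlgebra F P)}
    (h : ∀ i j, (i, j) ∈ P.carrier → coEntry lam i j = coEntry mu i j) : lam = mu := by
  have : coEntry lam = coEntry mu := by
    funext i j
    by_cases hij : (i, j) ∈ P.carrier
    · exact h i j hij
    · rw [coEntry_of_notMem lam hij, coEntry_of_notMem mu hij]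
  rw [← ofCoEntries_coEntry lam, ← ofCoEntries_coEntry mu, this]

theorem coSupp_subset_iff {lam : Module.Dual F (patternAlgebra F P)} {S : Set (Fin n × Fin n)} :
    coSupp lam ⊆ S ↔ ∀ i j, coEntry lam i j ≠ 0 → (i, j) ∈ S :=
  ⟨fun h _ _ hij => h (mem_coSupp.2 hij), fun h p hp => h p.1 p.2 hp.2⟩

theorem coEntry_eq_zero_of_coSupp_subset {lam : Module.Dual F (patternAlgebra F P)}
    {S : Set (Fin n × Fin n)} (h : coSupp lam ⊆ S) {i j : Fin n} (hij : (i, j) ∉ S) :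
    coEntry lam i j = 0 :=
  notMem_coSupp.1 fun h' => hij (h h')

open Classical in
theorem coEntry_coRestrict (S : Set (Fin n × Fin n)) (η : Module.Dual F (patternAlgebra F P))
    (i j : Fin n) : coEntry (coRestrict S η) i j = if (i, j) ∈ S then coEntry η i j else 0 := by
  by_cases h : (i, j) ∈ P.carrier
  · exact coEntry_ofCoEntries _ h
  · simp [coEntry_of_notMem _ h]

theorem coSupp_coRestrict_subset (S : Set (Fin n × Fin n))
    (η : Module.Dual F (patternAlgebra F P)) : coSupp (coRestrict S η) ⊆ S := by
  rw [coSupp_subset_iff]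
  intro i j h
  by_contra hS
  simp [coEntry_coRestrict, hS] at h

/-- The functionals supported in `S`. -/
def supportedIn (F : Type*) [Field F] {n : ℕ} (P : PosPoset n) (S : Set (Fin n × Fin n)) :
    Set (Module.Dual F (patternAlgebra F P)) :=
  {α | coSupp α ⊆ S}

theorem ncard_supportedIn [Finite F] {S : Set (Fin n × Fin n)} (hS : S ⊆ P.carrier) :
    (supportedIn F P S).ncard = Nat.card F ^ S.ncard := by
  classical
  have e : supportedIn F P S ≃ (S → F) :=
    { toFun := fun α p => coEntry α.1 p.1.1 p.1.2
      invFun := fun f => ⟨ofCoEntries P fun i j => if h : (i, j) ∈ S then f ⟨(i, j), h⟩ else 0, by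
        rw [supportedIn, Set.mem_ofPred_eq, coSupp_subset_iff]
        intro i j hij
        by_contra h
        rw [coEntry_ofCoEntries _ (mem_of_coEntry_ne_zero hij), dif_neg h] at hij
        exact hij rfl⟩
      left_inv := fun α => by
        refine Subtype.ext (dual_ext fun i j hij => ?_)
        rw [coEntry_ofCoEntries _ hij]
        split_ifs with h
        · rfl
        · exact (coEntry_eq_zero_of_coSupp_subset α.2 h).symm
      right_inv := fun f => by
        funext p
        have := coEntry_ofCoEntries (P := P)
          (fun i j => if h : (i, j) ∈ S then f ⟨(i, j), h⟩ else 0) (hS p.2)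
        simpa using this }
  rw [← Nat.card_coe_set_eq, Nat.card_congr e, Nat.card_fun, Nat.card_coe_set_eq]

end Entries

/-! ### The action as truncated multiplication by lower unitriangular matrices -/

section TriangularAction

open Matrix

variable {F : Type*} [Field F] {n : ℕ} {P : PosPoset n}

theorem PosPoset.IsNormal.mem (hP : P.IsNormal) {i j k l : Fin n} (hij : i ≤ j) (hkl : k ≤ l)
    (h : (j, k) ∈ P.carrier) : (i, l) ∈ P.carrier := by
  by_contra h'
  exact hP i j k l hij (P.lt_of_mem h) hkl h' h

/-- Lower unitriangular matrices whose transpose has the pattern `Q`. -/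
def lowerPattern (F : Type*) [Field F] {n : ℕ} (Q : PosPoset n) :
    Set (Matrix (Fin n) (Fin n) F) :=
  {A | Aᵀ - 1 ∈ patternAlgebra F Q}

theorem lowerPattern_apply_self {Q : PosPoset n} {A : Matrix (Fin n) (Fin n) F}
    (hA : A ∈ lowerPattern F Q) (i : Fin n) : A i i = 1 :=
  (isPatternUnipotent_iff.2 hA).1 i

theorem lowerPattern_apply_eq_zero {Q : PosPoset n} {A : Matrix (Fin n) (Fin n) F}
    (hA : A ∈ lowerPattern F Q) {i j : Fin n} (hij : i ≠ j) (h : (j, i) ∉ Q.carrier) :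
    A i j = 0 := by
  have := patternAlgebra_apply_eq_zero hA h
  simpa [Matrix.one_apply_ne hij.symm] using this

theorem mem_of_lowerPattern {Q : PosPoset n} {A : Matrix (Fin n) (Fin n) F}
    (hA : A ∈ lowerPattern F Q) {i j : Fin n} (hij : i ≠ j) (h : A i j ≠ 0) :
    (j, i) ∈ Q.carrier := by
  by_contra h'
  exact h (lowerPattern_apply_eq_zero hA hij h')

theorem le_of_lowerPattern {Q : PosPoset n} {A : Matrix (Fin n) (Fin n) F}
    (hA : A ∈ lowerPattern F Q) {i j : Fin n} (h : A i j ≠ 0) : j ≤ i := by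
  rcases eq_or_ne i j with rfl | hij
  · exact le_rfl
  · exact (Q.lt_of_mem (mem_of_lowerPattern hA hij h)).le

theorem mem_lowerPattern_of {Q : PosPoset n} {A : Matrix (Fin n) (Fin n) F}
    (h₁ : ∀ i, A i i = 1) (h₂ : ∀ i j, i ≠ j → A i j ≠ 0 → (j, i) ∈ Q.carrier) :
    A ∈ lowerPattern F Q := by
  intro i j h
  rcases eq_or_ne i j with rfl | hij
  · simp [h₁] at h
  · simp only [Matrix.sub_apply, Matrix.transpose_apply, Matrix.one_apply_ne hij, sub_zero] at h
    exact h₂ j i hij.symm h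

theorem lowerPattern_mono {Q : PosPoset n} {A : Matrix (Fin n) (Fin n) F}
    (hA : A ∈ lowerPattern F Q) : A ∈ lowerPattern F (PosPoset.full n) :=
  fun i j h => Q.lt_of_mem (hA i j h)

theorem one_mem_lowerPattern (Q : PosPoset n) :
    (1 : Matrix (Fin n) (Fin n) F) ∈ lowerPattern F Q := by
  simp [lowerPattern]

theorem mul_mem_lowerPattern {Q : PosPoset n} {A B : Matrix (Fin n) (Fin n) F}
    (hA : A ∈ lowerPattern F Q) (hB : B ∈ lowerPattern F Q) : A * B ∈ lowerPattern F Q := by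
  have e : (A * B)ᵀ - 1 = (Bᵀ - 1) * (Aᵀ - 1) + (Bᵀ - 1) + (Aᵀ - 1) := by
    rw [Matrix.transpose_mul]
    noncomm_ring
  show _ ∈ patternAlgebra F Q
  rw [e]
  exact add_mem (add_mem (patternAlgebra_mul_mem hB hA) hB) hA

/-- The lower unitriangular matrix attached to `g⁻¹`. -/
theorem transpose_inv_mem_lowerPattern [Finite F] {Q : PosPoset n} (g : patternGroup F Q) :
    (patternMatrix g⁻¹)ᵀ ∈ lowerPattern F Q := by
  show _ ∈ patternAlgebra F Q
  rw [Matrix.transpose_transpose]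
  exact isPatternUnipotent_iff.1 (g⁻¹).2

theorem exists_patternGroup_of_isPatternUnipotent [Finite F] {Q : PosPoset n}
    {M : Matrix (Fin n) (Fin n) F} (h : IsPatternUnipotent Q M) :
    ∃ g : patternGroup F Q, patternMatrix g = M := by
  have hdet : M.det = 1 := by
    rw [Matrix.det_of_isUpperTriangular (fun i j hij => h.2.1 i j hij)]
    exact Finset.prod_eq_one fun i _ => h.1 i
  refine ⟨⟨Matrix.nonsingInvUnit M (by simp [hdet]), h⟩, rfl⟩

theorem exists_transpose_inv_eq [Finite F] {Q : PosPoset n} {A : Matrix (Fin n) (Fin n) F}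
    (hA : A ∈ lowerPattern F Q) : ∃ g : patternGroup F Q, (patternMatrix g⁻¹)ᵀ = A := by
  obtain ⟨g, hg⟩ := exists_patternGroup_of_isPatternUnipotent (isPatternUnipotent_iff.2 hA)
  exact ⟨g⁻¹, by rw [inv_inv, hg, Matrix.transpose_transpose]⟩

theorem exists_inv_lowerPattern [Finite F] {Q : PosPoset n} {A : Matrix (Fin n) (Fin n) F}
    (hA : A ∈ lowerPattern F Q) : ∃ B ∈ lowerPattern F Q, A * B = 1 ∧ B * A = 1 := by
  obtain ⟨g, rfl⟩ := exists_transpose_inv_eq hA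
  refine ⟨(patternMatrix g)ᵀ, ?_, ?_, ?_⟩
  · simpa using transpose_inv_mem_lowerPattern g⁻¹
  · rw [← Matrix.transpose_mul, ← Matrix.transpose_one]
    congr 1
    simp [patternMatrix]
  · rw [← Matrix.transpose_mul, ← Matrix.transpose_one]
    congr 1
    simp [patternMatrix]

theorem mul_mem_patternAlgebra_left (hP : P.IsNormal) {A X : Matrix (Fin n) (Fin n) F}
    (hA : A ∈ lowerPattern F (PosPoset.full n)) (hX : X ∈ patternAlgebra F P) :
    Aᵀ * X ∈ patternAlgebra F P := by
  intro i k h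
  rw [Matrix.mul_apply] at h
  obtain ⟨j, -, hj⟩ := Finset.exists_ne_zero_of_sum_ne_zero h
  exact hP.mem (le_of_lowerPattern hA (left_ne_zero_of_mul hj)) le_rfl
    (hX j k (right_ne_zero_of_mul hj))

theorem mul_mem_patternAlgebra_right (hP : P.IsNormal) {A X : Matrix (Fin n) (Fin n) F}
    (hA : A ∈ lowerPattern F (PosPoset.full n)) (hX : X ∈ patternAlgebra F P) :
    X * Aᵀ ∈ patternAlgebra F P := by
  intro i k h
  rw [Matrix.mul_apply] at h
  obtain ⟨j, -, hj⟩ := Finset.exists_ne_zero_of_sum_ne_zero h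
  exact hP.mem le_rfl (le_of_lowerPattern hA (right_ne_zero_of_mul hj))
    (hX i j (left_ne_zero_of_mul hj))

/-- By normality `𝔫_P` absorbs unitriangular factors on both sides, so conjugation by the full group
preserves the condition that `Xᵀ - 1` lies in `𝔫_P`. -/
theorem conj_mem_lowerPattern (hP : P.IsNormal) {A B X : Matrix (Fin n) (Fin n) F}
    (hA : A ∈ lowerPattern F (PosPoset.full n)) (hB : B ∈ lowerPattern F (PosPoset.full n))
    (hBA : A * B = 1) (hX : X ∈ lowerPattern F P) : A * X * B ∈ lowerPattern F P := by
  have e : (A * X * B)ᵀ - 1 = Bᵀ * ((Xᵀ - 1) * Aᵀ) := by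
    have : Bᵀ * Aᵀ = 1 := by rw [← Matrix.transpose_mul, hBA, Matrix.transpose_one]
    rw [Matrix.transpose_mul, Matrix.transpose_mul, sub_mul, mul_sub, one_mul, this]
  show _ ∈ patternAlgebra F P
  rw [e]
  exact mul_mem_patternAlgebra_left hP hB (mul_mem_patternAlgebra_right hP hA hX)

theorem exists_mul_eq_mul_left [Finite F] (hP : P.IsNormal) {A X : Matrix (Fin n) (Fin n) F}
    (hA : A ∈ lowerPattern F (PosPoset.full n)) (hX : X ∈ lowerPattern F P) :
    ∃ Y ∈ lowerPattern F P, A * X = Y * A := by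
  obtain ⟨B, hB, hAB, hBA⟩ := exists_inv_lowerPattern hA
  exact ⟨A * X * B, conj_mem_lowerPattern hP hA hB hAB hX, by rw [mul_assoc, hBA, mul_one]⟩

theorem exists_mul_eq_mul_right [Finite F] (hP : P.IsNormal) {A X : Matrix (Fin n) (Fin n) F}
    (hA : A ∈ lowerPattern F (PosPoset.full n)) (hX : X ∈ lowerPattern F P) :
    ∃ Y ∈ lowerPattern F P, X * A = A * Y := by
  obtain ⟨B, hB, hAB, hBA⟩ := exists_inv_lowerPattern hA
  exact ⟨B * X * A, conj_mem_lowerPattern hP hB hA hBA hX, by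
    rw [← mul_assoc, ← mul_assoc, hAB, one_mul]⟩

/-- The matrix of entries of a functional. -/
noncomputable def coMatrix (lam : Module.Dual F (patternAlgebra F P)) :
    Matrix (Fin n) (Fin n) F :=
  Matrix.of (coEntry lam)

@[simp]
theorem coMatrix_apply (lam : Module.Dual F (patternAlgebra F P)) (i j : Fin n) :
    coMatrix lam i j = coEntry lam i j := rfl

/-- Two-sided multiplication of the matrix of entries, restricted to the positions in `P`. -/
noncomputable def biact (A B : Matrix (Fin n) (Fin n) F)
    (lam : Module.Dual F (patternAlgebra F P)) : Module.Dual F (patternAlgebra F P) :=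
  ofCoEntries P (A * coMatrix lam * B)

theorem coEntry_biact (A B : Matrix (Fin n) (Fin n) F) (lam : Module.Dual F (patternAlgebra F P))
    {i j : Fin n} (h : (i, j) ∈ P.carrier) :
    coEntry (biact A B lam) i j = (A * coMatrix lam * B) i j :=
  coEntry_ofCoEntries _ h

theorem coMatrix_add (lam mu : Module.Dual F (patternAlgebra F P)) :
    coMatrix (lam + mu) = coMatrix lam + coMatrix mu := by
  ext i j
  simp [coEntry_add]

theorem biact_add (A B : Matrix (Fin n) (Fin n) F) (lam mu : Module.Dual F (patternAlgebra F P)) :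
    biact A B (lam + mu) = biact A B lam + biact A B mu := by
  refine dual_ext fun i j h => ?_
  rw [coEntry_add, coEntry_biact _ _ _ h, coEntry_biact _ _ _ h, coEntry_biact _ _ _ h,
    coMatrix_add, mul_add, add_mul, Matrix.add_apply]

theorem biact_one_one (lam : Module.Dual F (patternAlgebra F P)) : biact 1 1 lam = lam := by
  refine dual_ext fun i j h => ?_
  rw [coEntry_biact _ _ _ h, one_mul, mul_one, coMatrix_apply]

/-- The `(i, j)` entry of the product involves only entries `(k, l)` with `k ≤ i` and `j ≤ l`.
Normality puts these in `P`, so whatever truncation discards never returns to a position of `P`. -/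
theorem mul_mul_apply_congr (hP : P.IsNormal) {A B M N : Matrix (Fin n) (Fin n) F}
    (hA : A ∈ lowerPattern F (PosPoset.full n)) (hB : B ∈ lowerPattern F (PosPoset.full n))
    (h : ∀ i j, (i, j) ∈ P.carrier → M i j = N i j) {i j : Fin n} (hij : (i, j) ∈ P.carrier) :
    (A * M * B) i j = (A * N * B) i j := by
  simp only [Matrix.mul_apply]
  refine Finset.sum_congr rfl fun l _ => ?_
  by_cases hl : B l j = 0
  · simp [hl]
  congr 1
  refine Finset.sum_congr rfl fun k _ => ?_
  by_cases hk : A i k = 0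
  · simp [hk]
  rw [h k l (hP.mem (le_of_lowerPattern hA hk) (le_of_lowerPattern hB hl) hij)]

theorem biact_biact (hP : P.IsNormal) {A B : Matrix (Fin n) (Fin n) F}
    (hA : A ∈ lowerPattern F (PosPoset.full n)) (hB : B ∈ lowerPattern F (PosPoset.full n))
    (C D : Matrix (Fin n) (Fin n) F) (lam : Module.Dual F (patternAlgebra F P)) :
    biact A B (biact C D lam) = biact (A * C) (D * B) lam := by
  refine dual_ext fun i j h => ?_
  rw [coEntry_biact _ _ _ h, coEntry_biact _ _ _ h,
    mul_mul_apply_congr hP hA hB (N := C * coMatrix lam * D)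
      (fun i j hij => by rw [coMatrix_apply, coEntry_biact _ _ _ hij]) h]
  simp only [mul_assoc]

theorem coEntry_biact_left {A : Matrix (Fin n) (Fin n) F}
    (lam : Module.Dual F (patternAlgebra F P)) {i j : Fin n} (h : (i, j) ∈ P.carrier) :
    coEntry (biact A 1 lam) i j = ∑ k, A i k * coEntry lam k j := by
  rw [coEntry_biact _ _ _ h, mul_one, Matrix.mul_apply]
  rfl

theorem coEntry_biact_right {B : Matrix (Fin n) (Fin n) F}
    (lam : Module.Dual F (patternAlgebra F P)) {i j : Fin n} (h : (i, j) ∈ P.carrier) :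
    coEntry (biact 1 B lam) i j = ∑ k, coEntry lam i k * B k j := by
  rw [coEntry_biact _ _ _ h, one_mul, Matrix.mul_apply]
  rfl

theorem sum_mul_eq_trace (M N : Matrix (Fin n) (Fin n) F) :
    ∑ i, ∑ j, M i j * N i j = (Mᵀ * N).trace := by
  rw [Finset.sum_comm]
  simp [Matrix.trace, Matrix.mul_apply]

/-- The pairing is the trace form `tr(Mᵀ X)`, for which multiplication by `g⁻¹` is adjoint to
multiplication by its transpose. Truncation costs nothing, since `X` vanishes off `P`. -/
theorem coLeft_eq_biact [Finite F] (g : patternGroup F P)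
    (lam : Module.Dual F (patternAlgebra F P)) :
    coLeft g lam = biact (patternMatrix g⁻¹)ᵀ 1 lam := by
  refine LinearMap.ext fun X => ?_
  show lam (patternLeftMul g⁻¹ X) = ∑ i, ∑ j, ((patternMatrix g⁻¹)ᵀ * coMatrix lam * 1 : Matrix (Fin n) (Fin n) F) i j *
    (X : Matrix (Fin n) (Fin n) F) i j
  rw [dual_apply lam, sum_mul_eq_trace]
  show ∑ i, ∑ j, coMatrix lam i j * (patternMatrix g⁻¹ * (X : Matrix (Fin n) (Fin n) F)) i j = _
  rw [sum_mul_eq_trace, mul_one, Matrix.transpose_mul, Matrix.transpose_transpose, mul_assoc]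

theorem coRight_eq_biact [Finite F] (g : patternGroup F P)
    (lam : Module.Dual F (patternAlgebra F P)) :
    coRight lam g = biact 1 (patternMatrix g⁻¹)ᵀ lam := by
  refine LinearMap.ext fun X => ?_
  show lam (patternRightMul g⁻¹ X) = ∑ i, ∑ j, (1 * coMatrix lam * (patternMatrix g⁻¹)ᵀ : Matrix (Fin n) (Fin n) F) i j *
    (X : Matrix (Fin n) (Fin n) F) i j
  rw [dual_apply lam, sum_mul_eq_trace]
  show ∑ i, ∑ j, coMatrix lam i j * ((X : Matrix (Fin n) (Fin n) F) * patternMatrix g⁻¹) i j = _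
  rw [sum_mul_eq_trace, one_mul, Matrix.transpose_mul, Matrix.transpose_transpose, ← mul_assoc,
    Matrix.trace_mul_comm, mul_assoc]

end TriangularAction

/-! ### One-sided and two-sided orbits -/

section Orbits

open Matrix

variable {F : Type*} [Field F] {n : ℕ} {P : PosPoset n}

/-- The orbit of a functional under left multiplication by `lowerPattern F Q`. -/
def leftOrbit (Q : PosPoset n) (lam : Module.Dual F (patternAlgebra F P)) :
    Set (Module.Dual F (patternAlgebra F P)) :=
  {mu | ∃ A ∈ lowerPattern F Q, mu = biact A 1 lam}

/-- The orbit of a functional under right multiplication by `lowerPattern F Q`. -/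
def rightOrbit (Q : PosPoset n) (lam : Module.Dual F (patternAlgebra F P)) :
    Set (Module.Dual F (patternAlgebra F P)) :=
  {mu | ∃ B ∈ lowerPattern F Q, mu = biact 1 B lam}

/-- The orbit of a functional under two-sided multiplication by `lowerPattern F Q`. -/
def biorbit (Q : PosPoset n) (lam : Module.Dual F (patternAlgebra F P)) :
    Set (Module.Dual F (patternAlgebra F P)) :=
  {mu | ∃ A ∈ lowerPattern F Q, ∃ B ∈ lowerPattern F Q, mu = biact A B lam}

theorem leftCoorbit_eq [Finite F] (lam : Module.Dual F (patternAlgebra F P)) :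
    leftCoorbit lam = leftOrbit P lam := by
  ext mu
  constructor
  · rintro ⟨g, rfl⟩
    exact ⟨_, transpose_inv_mem_lowerPattern g, coLeft_eq_biact g lam⟩
  · rintro ⟨A, hA, rfl⟩
    obtain ⟨g, rfl⟩ := exists_transpose_inv_eq hA
    exact ⟨g, (coLeft_eq_biact g lam).symm⟩

theorem biact_left_right (hP : P.IsNormal) {A B : Matrix (Fin n) (Fin n) F}
    (hA : A ∈ lowerPattern F (PosPoset.full n)) (lam : Module.Dual F (patternAlgebra F P)) :
    biact A 1 (biact 1 B lam) = biact A B lam := by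
  rw [biact_biact hP hA (one_mem_lowerPattern _), mul_one, mul_one]

theorem biact_right_left (hP : P.IsNormal) {A B : Matrix (Fin n) (Fin n) F}
    (hB : B ∈ lowerPattern F (PosPoset.full n)) (lam : Module.Dual F (patternAlgebra F P)) :
    biact 1 B (biact A 1 lam) = biact A B lam := by
  rw [biact_biact hP (one_mem_lowerPattern _) hB, one_mul, one_mul]

theorem twoSidedCoorbit_eq [Finite F] (hP : P.IsNormal)
    (lam : Module.Dual F (patternAlgebra F P)) : twoSidedCoorbit lam = biorbit P lam := by
  ext mu
  constructor
  · rintro ⟨g, h, rfl⟩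
    refine ⟨_, transpose_inv_mem_lowerPattern g, _, transpose_inv_mem_lowerPattern h, ?_⟩
    rw [coLeft_eq_biact, coRight_eq_biact,
      biact_right_left hP (lowerPattern_mono (transpose_inv_mem_lowerPattern h))]
  · rintro ⟨A, hA, B, hB, rfl⟩
    obtain ⟨g, rfl⟩ := exists_transpose_inv_eq hA
    obtain ⟨h, rfl⟩ := exists_transpose_inv_eq hB
    refine ⟨g, h, ?_⟩
    rw [coLeft_eq_biact, coRight_eq_biact, biact_right_left hP (lowerPattern_mono hB)]

theorem biact_injective [Finite F] (hP : P.IsNormal) {A B : Matrix (Fin n) (Fin n) F}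
    (hA : A ∈ lowerPattern F (PosPoset.full n)) (hB : B ∈ lowerPattern F (PosPoset.full n)) :
    Function.Injective (biact (P := P) A B) := by
  obtain ⟨A', hA', -, hAA⟩ := exists_inv_lowerPattern hA
  obtain ⟨B', hB', hBB, -⟩ := exists_inv_lowerPattern hB
  refine Function.LeftInverse.injective (g := biact A' B') fun lam => ?_
  rw [biact_biact hP hA' hB', hAA, hBB, biact_one_one]

theorem mem_biorbit_symm [Finite F] (hP : P.IsNormal) {Q : PosPoset n}
    {lam mu : Module.Dual F (patternAlgebra F P)} (h : mu ∈ biorbit Q lam) :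
    lam ∈ biorbit Q mu := by
  obtain ⟨A, hA, B, hB, rfl⟩ := h
  obtain ⟨A', hA', -, hAA⟩ := exists_inv_lowerPattern hA
  obtain ⟨B', hB', hBB, -⟩ := exists_inv_lowerPattern hB
  refine ⟨A', hA', B', hB', ?_⟩
  rw [biact_biact hP (lowerPattern_mono hA') (lowerPattern_mono hB'), hAA, hBB, biact_one_one]

theorem mem_biorbit_trans (hP : P.IsNormal) {Q : PosPoset n}
    {lam mu nu : Module.Dual F (patternAlgebra F P)} (h : mu ∈ biorbit Q lam)
    (h' : nu ∈ biorbit Q mu) : nu ∈ biorbit Q lam := by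
  obtain ⟨A, hA, B, hB, rfl⟩ := h
  obtain ⟨A', hA', B', hB', rfl⟩ := h'
  exact ⟨A' * A, mul_mem_lowerPattern hA' hA, B * B', mul_mem_lowerPattern hB hB',
    biact_biact hP (lowerPattern_mono hA') (lowerPattern_mono hB') _ _ _⟩

theorem self_mem_biorbit (Q : PosPoset n) (lam : Module.Dual F (patternAlgebra F P)) :
    lam ∈ biorbit Q lam :=
  ⟨1, one_mem_lowerPattern Q, 1, one_mem_lowerPattern Q, (biact_one_one lam).symm⟩

theorem biorbit_eq_of_mem [Finite F] (hP : P.IsNormal) {Q : PosPoset n}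
    {lam mu : Module.Dual F (patternAlgebra F P)} (h : mu ∈ biorbit Q lam) :
    biorbit Q mu = biorbit Q lam :=
  Set.Subset.antisymm (fun _ h' => mem_biorbit_trans hP h h')
    fun _ h' => mem_biorbit_trans hP (mem_biorbit_symm hP h) h'

theorem biorbit_mono {Q : PosPoset n} (lam : Module.Dual F (patternAlgebra F P)) :
    biorbit Q lam ⊆ biorbit (PosPoset.full n) lam := by
  rintro _ ⟨A, hA, B, hB, rfl⟩
  exact ⟨A, lowerPattern_mono hA, B, lowerPattern_mono hB, rfl⟩

/-- Since the full group normalizes the `P`-pattern matrices, a factor `X` can be moved past `A` at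
the price of replacing it by a conjugate: full translations carry `P`-orbits to `P`-orbits. -/
theorem leftOrbit_biact [Finite F] (hP : P.IsNormal) {A B : Matrix (Fin n) (Fin n) F}
    (hA : A ∈ lowerPattern F (PosPoset.full n)) (hB : B ∈ lowerPattern F (PosPoset.full n))
    (lam : Module.Dual F (patternAlgebra F P)) :
    leftOrbit P (biact A B lam) = biact A B '' leftOrbit P lam := by
  ext mu
  constructor
  · rintro ⟨X, hX, rfl⟩
    obtain ⟨Y, hY, e⟩ := exists_mul_eq_mul_right hP hA hX
    refine ⟨_, ⟨Y, hY, rfl⟩, ?_⟩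
    rw [biact_biact hP hA hB, biact_biact hP (lowerPattern_mono hX) (one_mem_lowerPattern _), e,
      one_mul, mul_one]
  · rintro ⟨_, ⟨X, hX, rfl⟩, rfl⟩
    obtain ⟨Y, hY, e⟩ := exists_mul_eq_mul_left hP hA hX
    refine ⟨Y, hY, ?_⟩
    rw [biact_biact hP hA hB, biact_biact hP (lowerPattern_mono hY) (one_mem_lowerPattern _), e,
      one_mul, mul_one]

theorem biorbit_biact [Finite F] (hP : P.IsNormal) {A B : Matrix (Fin n) (Fin n) F}
    (hA : A ∈ lowerPattern F (PosPoset.full n)) (hB : B ∈ lowerPattern F (PosPoset.full n))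
    (lam : Module.Dual F (patternAlgebra F P)) :
    biorbit P (biact A B lam) = biact A B '' biorbit P lam := by
  ext mu
  constructor
  · rintro ⟨X, hX, X', hX', rfl⟩
    obtain ⟨Y, hY, e⟩ := exists_mul_eq_mul_right hP hA hX
    obtain ⟨Y', hY', e'⟩ := exists_mul_eq_mul_left hP hB hX'
    refine ⟨_, ⟨Y, hY, Y', hY', rfl⟩, ?_⟩
    rw [biact_biact hP hA hB, biact_biact hP (lowerPattern_mono hX) (lowerPattern_mono hX'), e, e']
  · rintro ⟨_, ⟨X, hX, X', hX', rfl⟩, rfl⟩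
    obtain ⟨Y, hY, e⟩ := exists_mul_eq_mul_left hP hA hX
    obtain ⟨Y', hY', e'⟩ := exists_mul_eq_mul_right hP hB hX'
    refine ⟨Y, hY, Y', hY', ?_⟩
    rw [biact_biact hP hA hB, biact_biact hP (lowerPattern_mono hY) (lowerPattern_mono hY'), e, e']

theorem ncard_leftOrbit_biact [Finite F] (hP : P.IsNormal) {A B : Matrix (Fin n) (Fin n) F}
    (hA : A ∈ lowerPattern F (PosPoset.full n)) (hB : B ∈ lowerPattern F (PosPoset.full n))
    (lam : Module.Dual F (patternAlgebra F P)) :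
    (leftOrbit P (biact A B lam)).ncard = (leftOrbit P lam).ncard := by
  rw [leftOrbit_biact hP hA hB, Set.ncard_image_of_injective _ (biact_injective hP hA hB)]

theorem ncard_biorbit_biact [Finite F] (hP : P.IsNormal) {A B : Matrix (Fin n) (Fin n) F}
    (hA : A ∈ lowerPattern F (PosPoset.full n)) (hB : B ∈ lowerPattern F (PosPoset.full n))
    (lam : Module.Dual F (patternAlgebra F P)) :
    (biorbit P (biact A B lam)).ncard = (biorbit P lam).ncard := by
  rw [biorbit_biact hP hA hB, Set.ncard_image_of_injective _ (biact_injective hP hA hB)]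

theorem rightOrbit_biact_left (hP : P.IsNormal) (Q : PosPoset n) {A : Matrix (Fin n) (Fin n) F}
    (hA : A ∈ lowerPattern F (PosPoset.full n)) (lam : Module.Dual F (patternAlgebra F P)) :
    rightOrbit Q (biact A 1 lam) = biact A 1 '' rightOrbit Q lam := by
  ext mu
  constructor
  · rintro ⟨B, hB, rfl⟩
    exact ⟨_, ⟨B, hB, rfl⟩, by
      rw [biact_left_right hP hA, biact_right_left hP (lowerPattern_mono hB)]⟩
  · rintro ⟨_, ⟨B, hB, rfl⟩, rfl⟩
    exact ⟨B, hB, by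
      rw [biact_left_right hP hA, biact_right_left hP (lowerPattern_mono hB)]⟩

theorem mem_rightOrbit_symm [Finite F] (hP : P.IsNormal) {Q : PosPoset n}
    {lam mu : Module.Dual F (patternAlgebra F P)} (h : mu ∈ rightOrbit Q lam) :
    lam ∈ rightOrbit Q mu := by
  obtain ⟨B, hB, rfl⟩ := h
  obtain ⟨B', hB', hBB, -⟩ := exists_inv_lowerPattern hB
  refine ⟨B', hB', ?_⟩
  rw [biact_biact hP (one_mem_lowerPattern _) (lowerPattern_mono hB'), mul_one, hBB,
    biact_one_one]

theorem mem_rightOrbit_trans (hP : P.IsNormal) {Q : PosPoset n}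
    {lam mu nu : Module.Dual F (patternAlgebra F P)} (h : mu ∈ rightOrbit Q lam)
    (h' : nu ∈ rightOrbit Q mu) : nu ∈ rightOrbit Q lam := by
  obtain ⟨B, hB, rfl⟩ := h
  obtain ⟨B', hB', rfl⟩ := h'
  refine ⟨B * B', mul_mem_lowerPattern hB hB', ?_⟩
  rw [biact_biact hP (one_mem_lowerPattern _) (lowerPattern_mono hB'), one_mul]

theorem biact_image_leftOrbit [Finite F] (hP : P.IsNormal) {Q : PosPoset n}
    {A : Matrix (Fin n) (Fin n) F} (hA : A ∈ lowerPattern F Q)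
    (lam : Module.Dual F (patternAlgebra F P)) :
    biact A 1 '' leftOrbit Q lam = leftOrbit Q lam := by
  have h₁ := one_mem_lowerPattern (F := F) (PosPoset.full n)
  ext mu
  constructor
  · rintro ⟨_, ⟨X, hX, rfl⟩, rfl⟩
    exact ⟨A * X, mul_mem_lowerPattern hA hX, by
      rw [biact_biact hP (lowerPattern_mono hA) h₁, one_mul]⟩
  · rintro ⟨X, hX, rfl⟩
    obtain ⟨A', hA', hAA, -⟩ := exists_inv_lowerPattern hA
    refine ⟨_, ⟨A' * X, mul_mem_lowerPattern hA' hX, rfl⟩, ?_⟩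
    rw [biact_biact hP (lowerPattern_mono hA) h₁, ← mul_assoc, hAA, one_mul, one_mul]

/-- The product formula for the size of a two-sided orbit. -/
theorem ncard_leftOrbit_mul_ncard_rightOrbit [Finite F] (hP : P.IsNormal) (Q : PosPoset n)
    (lam : Module.Dual F (patternAlgebra F P)) :
    (leftOrbit Q lam).ncard * (rightOrbit Q lam).ncard =
      (biorbit Q lam).ncard * (leftOrbit Q lam ∩ rightOrbit Q lam).ncard := by
  classical
  have h₁ := one_mem_lowerPattern (F := F) (PosPoset.full n)
  -- Count pairs `(α, τ)` with `α` in the left orbit and `τ` in the right orbit of `α`. For `α = A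
  -- lam` the possible `τ` form the `A`-translate of the right orbit of `lam`. For `τ = A lam B` the
  -- possible `α` form the `A`-translate of the intersection of the two orbits of `lam`.
  have key := Finset.card_mul_eq_card_mul
    (s := (Set.toFinite (leftOrbit Q lam)).toFinset)
    (t := (Set.toFinite (biorbit Q lam)).toFinset)
    (m := (rightOrbit Q lam).ncard) (n := (leftOrbit Q lam ∩ rightOrbit Q lam).ncard)
    (fun α τ => τ ∈ rightOrbit Q α) ?_ ?_
  · rwa [← Set.ncard_eq_toFinset_card, ← Set.ncard_eq_toFinset_card] at key
  · intro α hα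
    rw [Set.Finite.mem_toFinset] at hα
    obtain ⟨A, hA, rfl⟩ := hα
    have hA' := lowerPattern_mono hA
    have e : Finset.bipartiteAbove (fun α τ => τ ∈ rightOrbit Q α)
        (Set.toFinite (biorbit Q lam)).toFinset (biact A 1 lam) =
        (Set.toFinite (rightOrbit Q (biact A 1 lam))).toFinset := by
      ext τ
      simp only [Finset.mem_bipartiteAbove, Set.Finite.mem_toFinset, and_iff_right_iff_imp]
      rintro ⟨B, hB, rfl⟩
      exact ⟨A, hA, B, hB, biact_right_left hP (lowerPattern_mono hB) lam⟩
    rw [e, ← Set.ncard_eq_toFinset_card, rightOrbit_biact_left hP Q hA',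
      Set.ncard_image_of_injective _ (biact_injective hP hA' h₁)]
  · intro τ hτ
    rw [Set.Finite.mem_toFinset] at hτ
    obtain ⟨A, hA, B, hB, rfl⟩ := hτ
    have hA' := lowerPattern_mono hA
    have hmem : biact A B lam ∈ rightOrbit Q (biact A 1 lam) :=
      ⟨B, hB, (biact_right_left hP (lowerPattern_mono hB) lam).symm⟩
    have e : Finset.bipartiteBelow (fun α τ => τ ∈ rightOrbit Q α)
        (Set.toFinite (leftOrbit Q lam)).toFinset (biact A B lam) =
        (Set.toFinite (leftOrbit Q lam ∩ rightOrbit Q (biact A 1 lam))).toFinset := by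
      ext α
      simp only [Finset.mem_bipartiteBelow, Set.Finite.mem_toFinset, Set.mem_inter_iff,
        and_congr_right_iff]
      exact fun _ => ⟨fun h => mem_rightOrbit_trans hP hmem (mem_rightOrbit_symm hP h),
        fun h => mem_rightOrbit_trans hP (mem_rightOrbit_symm hP h) hmem⟩
    rw [e, ← Set.ncard_eq_toFinset_card, rightOrbit_biact_left hP Q hA']
    conv_lhs => rw [← biact_image_leftOrbit hP hA lam]
    rw [← Set.image_inter (biact_injective hP hA' h₁),
      Set.ncard_image_of_injective _ (biact_injective hP hA' h₁)]

end Orbits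

/-! ### Orbits of labeled set partitions -/

section SetPartitions

open Matrix

variable {F : Type*} [Field F] {n : ℕ} {P : PosPoset n}
  {lam : Module.Dual F (patternAlgebra F P)}

theorem coSetPartitions_row (h : lam ∈ coSetPartitions F P) {i k l : Fin n}
    (hk : coEntry lam i k ≠ 0) (hl : coEntry lam i l ≠ 0) : k = l :=
  congrArg Prod.snd (h (i, k) (mem_coSupp.2 hk) (i, l) (mem_coSupp.2 hl) (Or.inl rfl))

theorem coSetPartitions_col (h : lam ∈ coSetPartitions F P) {i j k : Fin n}
    (hi : coEntry lam i k ≠ 0) (hj : coEntry lam j k ≠ 0) : i = j :=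
  congrArg Prod.fst (h (i, k) (mem_coSupp.2 hi) (j, k) (mem_coSupp.2 hj) (Or.inr rfl))

theorem mem_coadjL {Q : PosPoset n} {j k : Fin n} :
    (j, k) ∈ coadjL Q lam ↔
      (j, k) ∈ P.carrier ∧ ∃ i, coEntry lam i k ≠ 0 ∧ (i, j) ∈ Q.carrier := by
  simp only [coadjL, Set.mem_ofPred_eq, mem_coSupp]

theorem mem_coadjR {Q : PosPoset n} {i j : Fin n} :
    (i, j) ∈ coadjR Q lam ↔
      (i, j) ∈ P.carrier ∧ ∃ k, coEntry lam i k ≠ 0 ∧ (j, k) ∈ Q.carrier := by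
  simp only [coadjR, Set.mem_ofPred_eq, mem_coSupp]

theorem biact_left_sub_mem {Q : PosPoset n} {A : Matrix (Fin n) (Fin n) F}
    (hA : A ∈ lowerPattern F Q) : biact A 1 lam - lam ∈ supportedIn F P (coadjL Q lam) := by
  rw [supportedIn, Set.mem_ofPred_eq, coSupp_subset_iff]
  intro j k h
  have hjk := mem_of_coEntry_ne_zero h
  rw [coEntry_sub, coEntry_biact_left _ hjk, ← Finset.add_sum_erase _ _ (Finset.mem_univ j),
    lowerPattern_apply_self hA, one_mul, add_sub_cancel_left] at h
  obtain ⟨i, hi, hne⟩ := Finset.exists_ne_zero_of_sum_ne_zero h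
  exact mem_coadjL.2 ⟨hjk, i, right_ne_zero_of_mul hne,
    mem_of_lowerPattern hA (Finset.ne_of_mem_erase hi).symm (left_ne_zero_of_mul hne)⟩

theorem biact_right_sub_mem {Q : PosPoset n} {B : Matrix (Fin n) (Fin n) F}
    (hB : B ∈ lowerPattern F Q) : biact 1 B lam - lam ∈ supportedIn F P (coadjR Q lam) := by
  rw [supportedIn, Set.mem_ofPred_eq, coSupp_subset_iff]
  intro j k h
  have hjk := mem_of_coEntry_ne_zero h
  rw [coEntry_sub, coEntry_biact_right _ hjk, ← Finset.add_sum_erase _ _ (Finset.mem_univ k),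
    lowerPattern_apply_self hB, mul_one, add_sub_cancel_left] at h
  obtain ⟨i, hi, hne⟩ := Finset.exists_ne_zero_of_sum_ne_zero h
  exact mem_coadjR.2 ⟨hjk, i, left_ne_zero_of_mul hne,
    mem_of_lowerPattern hB (Finset.ne_of_mem_erase hi) (right_ne_zero_of_mul hne)⟩

theorem exists_biact_left_eq_add (hlam : lam ∈ coSetPartitions F P) {Q : PosPoset n}
    {α : Module.Dual F (patternAlgebra F P)} (hα : α ∈ supportedIn F P (coadjL Q lam)) :
    ∃ A ∈ lowerPattern F Q, biact A 1 lam = lam + α := by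
  classical
  -- The coefficient is the multiple of row `i` to add to row `j`. At most one `k` contributes, the
  -- one with `(i, k)` in the support, because `0⁻¹ = 0`. Each column meets at most one row of the
  -- support, so the prescriptions do not interfere.
  refine ⟨Matrix.of fun j i => if i = j then 1 else if (i, j) ∈ Q.carrier then
    ∑ k, coEntry α j k * (coEntry lam i k)⁻¹ else 0, ?_, ?_⟩
  · refine mem_lowerPattern_of (fun i => by simp) fun j i hij h => ?_
    by_contra h'
    simp [hij.symm, h'] at h
  · refine dual_ext fun j k hjk => ?_
    rw [coEntry_biact_left _ hjk, coEntry_add, ← Finset.add_sum_erase _ _ (Finset.mem_univ j)]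
    simp only [Matrix.of_apply, if_true, one_mul]
    congr 1
    have hterm : ∀ i ∈ Finset.univ.erase j, (if i = j then (1 : F) else
        if (i, j) ∈ Q.carrier then ∑ k, coEntry α j k * (coEntry lam i k)⁻¹ else 0) *
          coEntry lam i k =
        if (i, j) ∈ Q.carrier ∧ coEntry lam i k ≠ 0 then coEntry α j k else 0 := by
      intro i hi
      rw [if_neg (Finset.ne_of_mem_erase hi)]
      by_cases hQ : (i, j) ∈ Q.carrier
      · by_cases hk : coEntry lam i k = 0
        · simp [hk]
        · rw [if_pos hQ, if_pos ⟨hQ, hk⟩, Finset.sum_eq_single k, mul_assoc, inv_mul_cancel₀ hk,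
            mul_one]
          · intro l _ hl
            have : coEntry lam i l = 0 := by
              by_contra h'
              exact hl (coSetPartitions_row hlam h' hk)
            simp [this]
          · simp
      · simp [hQ]
    rw [Finset.sum_congr rfl hterm]
    by_cases h0 : coEntry α j k = 0
    · simp [h0]
    · obtain ⟨-, i, hi, hQ⟩ := mem_coadjL.1 (hα (mem_coSupp.2 h0))
      rw [Finset.sum_eq_single i, if_pos ⟨hQ, hi⟩]
      · intro i' _ hi'
        rw [if_neg]
        rintro ⟨-, h'⟩
        exact hi' (coSetPartitions_col hlam h' hi)
      · intro h'
        exact absurd (Finset.mem_erase.2 ⟨(Q.lt_of_mem hQ).ne, Finset.mem_univ _⟩) h'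

theorem exists_biact_right_eq_add (hlam : lam ∈ coSetPartitions F P) {Q : PosPoset n}
    {α : Module.Dual F (patternAlgebra F P)} (hα : α ∈ supportedIn F P (coadjR Q lam)) :
    ∃ B ∈ lowerPattern F Q, biact 1 B lam = lam + α := by
  classical
  -- Dually, the multiple of column `l` to add to column `k`; only the row `i` with `(i, l)` in the
  -- support contributes.
  refine ⟨Matrix.of fun l k => if l = k then 1 else if (k, l) ∈ Q.carrier then
    ∑ i, (coEntry lam i l)⁻¹ * coEntry α i k else 0, ?_, ?_⟩
  · refine mem_lowerPattern_of (fun i => by simp) fun l k hij h => ?_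
    by_contra h'
    simp [hij, h'] at h
  · refine dual_ext fun j k hjk => ?_
    rw [coEntry_biact_right _ hjk, coEntry_add, ← Finset.add_sum_erase _ _ (Finset.mem_univ k)]
    simp only [Matrix.of_apply, if_true, mul_one]
    congr 1
    have hterm : ∀ l ∈ Finset.univ.erase k, coEntry lam j l * (if l = k then (1 : F) else
        if (k, l) ∈ Q.carrier then ∑ i, (coEntry lam i l)⁻¹ * coEntry α i k else 0) =
        if (k, l) ∈ Q.carrier ∧ coEntry lam j l ≠ 0 then coEntry α j k else 0 := by
      intro l hl
      rw [if_neg (Finset.ne_of_mem_erase hl)]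
      by_cases hQ : (k, l) ∈ Q.carrier
      · by_cases hk : coEntry lam j l = 0
        · simp [hk]
        · rw [if_pos hQ, if_pos ⟨hQ, hk⟩, Finset.sum_eq_single j, ← mul_assoc, mul_inv_cancel₀ hk,
            one_mul]
          · intro i _ hi
            have : coEntry lam i l = 0 := by
              by_contra h'
              exact hi (coSetPartitions_col hlam h' hk)
            simp [this]
          · simp
      · simp [hQ]
    rw [Finset.sum_congr rfl hterm]
    by_cases h0 : coEntry α j k = 0
    · simp [h0]
    · obtain ⟨-, l, hl, hQ⟩ := mem_coadjR.1 (hα (mem_coSupp.2 h0))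
      rw [Finset.sum_eq_single l, if_pos ⟨hQ, hl⟩]
      · intro i' _ hi'
        rw [if_neg]
        rintro ⟨-, h'⟩
        exact hi' (coSetPartitions_row hlam h' hl)
      · intro h'
        exact absurd (Finset.mem_erase.2 ⟨(Q.lt_of_mem hQ).ne', Finset.mem_univ _⟩) h'

theorem leftOrbit_eq_image (hlam : lam ∈ coSetPartitions F P) (Q : PosPoset n) :
    leftOrbit Q lam = (lam + ·) '' supportedIn F P (coadjL Q lam) := by
  ext mu
  constructor
  · rintro ⟨A, hA, rfl⟩
    exact ⟨_, biact_left_sub_mem hA, add_sub_cancel _ _⟩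
  · rintro ⟨α, hα, rfl⟩
    obtain ⟨A, hA, e⟩ := exists_biact_left_eq_add hlam hα
    exact ⟨A, hA, e.symm⟩

theorem rightOrbit_eq_image (hlam : lam ∈ coSetPartitions F P) (Q : PosPoset n) :
    rightOrbit Q lam = (lam + ·) '' supportedIn F P (coadjR Q lam) := by
  ext mu
  constructor
  · rintro ⟨A, hA, rfl⟩
    exact ⟨_, biact_right_sub_mem hA, add_sub_cancel _ _⟩
  · rintro ⟨α, hα, rfl⟩
    obtain ⟨A, hA, e⟩ := exists_biact_right_eq_add hlam hα
    exact ⟨A, hA, e.symm⟩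

theorem supportedIn_inter (S T : Set (Fin n × Fin n)) :
    supportedIn F P S ∩ supportedIn F P T = supportedIn F P (S ∩ T) := by
  ext α
  exact Set.subset_inter_iff.symm

theorem coadjL_subset (Q : PosPoset n) : coadjL Q lam ⊆ P.carrier := fun _ h => h.1

theorem coadjR_subset (Q : PosPoset n) : coadjR Q lam ⊆ P.carrier := fun _ h => h.1

theorem coadj_subset (Q : PosPoset n) : coadj Q lam ⊆ P.carrier :=
  Set.union_subset (coadjL_subset Q) (coadjR_subset Q)

theorem ncard_leftOrbit [Finite F] (hlam : lam ∈ coSetPartitions F P) (Q : PosPoset n) :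
    (leftOrbit Q lam).ncard = Nat.card F ^ (coadjL Q lam).ncard := by
  rw [leftOrbit_eq_image hlam, Set.ncard_image_of_injective _ (add_right_injective lam),
    ncard_supportedIn (coadjL_subset Q)]

theorem ncard_rightOrbit [Finite F] (hlam : lam ∈ coSetPartitions F P) (Q : PosPoset n) :
    (rightOrbit Q lam).ncard = Nat.card F ^ (coadjR Q lam).ncard := by
  rw [rightOrbit_eq_image hlam, Set.ncard_image_of_injective _ (add_right_injective lam),
    ncard_supportedIn (coadjR_subset Q)]

theorem ncard_biorbit [Finite F] (hP : P.IsNormal) (hlam : lam ∈ coSetPartitions F P)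
    (Q : PosPoset n) : (biorbit Q lam).ncard = Nat.card F ^ (coadj Q lam).ncard := by
  have h := ncard_leftOrbit_mul_ncard_rightOrbit hP Q lam
  have hI : (leftOrbit Q lam ∩ rightOrbit Q lam).ncard =
      Nat.card F ^ (coadjL Q lam ∩ coadjR Q lam).ncard := by
    rw [leftOrbit_eq_image hlam, rightOrbit_eq_image hlam,
      ← Set.image_inter (add_right_injective lam), supportedIn_inter,
      Set.ncard_image_of_injective _ (add_right_injective lam),
      ncard_supportedIn (Set.inter_subset_left.trans (coadjL_subset Q))]
  have hq : 0 < Nat.card F := Nat.card_pos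
  rw [hI, ncard_leftOrbit hlam, ncard_rightOrbit hlam, ← pow_add,
    ← Set.ncard_union_add_ncard_inter _ _, pow_add] at h
  exact (Nat.eq_of_mul_eq_mul_right (pow_pos hq _) h).symm

/-- Both sets count the triples `(i, j, k)` with `(i, k)` in the support and `(i, j)`, `(j, k)` in
`P`; the bijection sends `(j, k)` to `(i, j)`. -/
theorem ncard_coadjL_eq_ncard_coadjR (hlam : lam ∈ coSetPartitions F P) :
    (coadjL P lam).ncard = (coadjR P lam).ncard := by
  classical
  have hL : ∀ p ∈ coadjL P lam, ∃ i, coEntry lam i p.2 ≠ 0 ∧ (i, p.1) ∈ P.carrier :=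
    fun p hp => (mem_coadjL.1 hp).2
  choose f hf hf' using hL
  refine Set.ncard_congr (fun p hp => (f p hp, p.1)) ?_ ?_ ?_
  · rintro ⟨j, k⟩ hp
    exact mem_coadjR.2 ⟨hf' _ hp, k, hf _ hp, hp.1⟩
  · rintro ⟨j, k⟩ ⟨j', k'⟩ hp hp' h
    obtain ⟨h₁, rfl⟩ := Prod.mk.inj h
    have h₂ := hf _ hp'
    rw [← h₁] at h₂
    exact Prod.ext rfl (coSetPartitions_row hlam (hf _ hp) h₂)
  · rintro ⟨i, j⟩ hp
    obtain ⟨hij, k, hk, hjk⟩ := mem_coadjR.1 hp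
    have hp' : (j, k) ∈ coadjL P lam := mem_coadjL.2 ⟨hjk, i, hk, hij⟩
    exact ⟨(j, k), hp', by rw [coSetPartitions_col hlam (hf _ hp') hk]⟩

end SetPartitions

/-! ### Representatives of the orbits of the pattern group -/

section Representatives

open Matrix

variable {F : Type*} [Field F] {n : ℕ} {P : PosPoset n}
  {lam : Module.Dual F (patternAlgebra F P)}

/-- Row `i` is the only one meeting column `l`, so `α` determines this entry of `A`, whichever `A`
was chosen. -/
theorem lowerPattern_mul_coEntry (hlam : lam ∈ coSetPartitions F P)
    {A : Matrix (Fin n) (Fin n) F} {α : Module.Dual F (patternAlgebra F P)}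
    (h : biact A 1 lam = lam + α) {i j l : Fin n} (hij : i ≠ j) (hil : coEntry lam i l ≠ 0)
    (hjl : (j, l) ∈ P.carrier) : A j i * coEntry lam i l = coEntry α j l := by
  have e := congrArg (fun mu => coEntry mu j l) h
  simp only [coEntry_biact_left _ hjl, coEntry_add] at e
  have h0 : coEntry lam j l = 0 := by
    by_contra h'
    exact hij (coSetPartitions_col hlam hil h')
  rw [h0, zero_add, Finset.sum_eq_single i] at e
  · exact e
  · intro k _ hk
    have : coEntry lam k l = 0 := by
      by_contra h'
      exact hk (coSetPartitions_col hlam h' hil)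
    rw [this, mul_zero]
  · simp

/-- This explains the product `*_lam`. Expanding, `A (lam + μ) = lam + α + A μ`, and the
off-diagonal part of `A μ` is the quadratic term: each relevant entry `A j i` equals `α_{jl} /
lam_{il}`. -/
theorem biact_eq_add_coStar (hP : P.IsNormal) (hlam : lam ∈ coSetPartitions F P)
    {A B : Matrix (Fin n) (Fin n) F} (hA : A ∈ lowerPattern F (PosPoset.full n))
    (hB : B ∈ lowerPattern F (PosPoset.full n)) {α μ : Module.Dual F (patternAlgebra F P)}
    (hα : biact A 1 lam = lam + α) (hμ : biact 1 B lam = lam + μ) :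
    biact A B lam = lam + coStar lam α μ := by
  classical
  have hμ' : μ ∈ supportedIn F P (coadjR (PosPoset.full n) lam) := by
    have := biact_right_sub_mem (lam := lam) hB
    rwa [hμ, add_sub_cancel_left] at this
  rw [← biact_left_right hP hA, hμ, biact_add, hα]
  refine dual_ext fun j k hjk => ?_
  rw [coEntry_add, coEntry_add, coEntry_add, coEntry_biact_left _ hjk, coStar,
    coEntry_ofCoEntries _ hjk, Finset.sum_filter, Fintype.sum_prod_type,
    ← Finset.add_sum_erase _ _ (Finset.mem_univ j), lowerPattern_apply_self hA, one_mul,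
    ← Finset.add_sum_erase (Finset.univ : Finset (Fin n)) (fun i => ∑ l, ite _ _ _)
      (Finset.mem_univ j)]
  have hj : ∑ l, (if (j, l).1 < j ∧ j < k ∧ k < (j, l).2 ∧ (j, l) ∈ coSupp lam then
      coEntry α j (j, l).2 * coEntry μ (j, l).1 k * (coEntry lam (j, l).1 (j, l).2)⁻¹
      else 0) = 0 := Finset.sum_eq_zero fun l _ => if_neg fun h => lt_irrefl j h.1
  rw [hj, zero_add, ← add_assoc, ← add_assoc, ← add_assoc]
  congr 1
  refine Finset.sum_congr rfl fun i hi => ?_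
  have hij : i ≠ j := Finset.ne_of_mem_erase hi
  by_cases h0 : coEntry μ i k = 0
  · simp [h0]
  -- A nonzero `μ_{ik}` forces a support position `(i, l)` with `k < l`; it is the only one in row
  -- `i`, so the inner sum has at most one term.
  obtain ⟨-, l, hl, hkl⟩ := mem_coadjR.1 (hμ' (mem_coSupp.2 h0))
  have hkl' : k < l := hkl
  by_cases hlt : i < j
  · rw [Finset.sum_eq_single l, if_pos ⟨hlt, P.lt_of_mem hjk, hkl', mem_coSupp.2 hl⟩,
      ← lowerPattern_mul_coEntry hlam hα hij hl (hP.mem le_rfl hkl'.le hjk)]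
    · field_simp
    · intro l' _ hl'
      refine if_neg fun h => hl' ?_
      exact coSetPartitions_row hlam (mem_coSupp.1 h.2.2.2) hl
    · simp
  · have hA0 : A j i = 0 := by
      by_contra h'
      exact hlt (lt_of_le_of_ne (le_of_lowerPattern hA h') hij)
    rw [hA0, zero_mul]
    exact (Finset.sum_eq_zero fun l _ => if_neg fun h => hlt h.1).symm

theorem coauxL_subset : coauxL P lam ⊆ coadjL (PosPoset.full n) lam := Set.sdiff_subset

theorem coauxR_subset : coauxR P lam ⊆ coadjR (PosPoset.full n) lam := Set.sdiff_subset

theorem exists_biact_eq_add_coRep (hP : P.IsNormal) (hlam : lam ∈ coSetPartitions F P)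
    (η : Module.Dual F (patternAlgebra F P)) :
    ∃ A ∈ lowerPattern F (PosPoset.full n), ∃ B ∈ lowerPattern F (PosPoset.full n),
      biact A 1 lam = lam + coRestrict (coauxL P lam) η ∧
      biact 1 B lam = lam + coRestrict (coauxR P lam \ coauxL P lam) η ∧
      biact A B lam = lam + coRep lam η := by
  obtain ⟨A, hA, eA⟩ := exists_biact_left_eq_add hlam (Q := PosPoset.full n)
    (α := coRestrict (coauxL P lam) η) ((coSupp_coRestrict_subset _ _).trans coauxL_subset)
  obtain ⟨B, hB, eB⟩ := exists_biact_right_eq_add hlam (Q := PosPoset.full n)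
    (α := coRestrict (coauxR P lam \ coauxL P lam) η)
    ((coSupp_coRestrict_subset _ _).trans (Set.sdiff_subset.trans coauxR_subset))
  exact ⟨A, hA, B, hB, eA, eB, biact_eq_add_coStar hP hlam hA hB eA eB⟩

/-- Induction on the row, starting from `lam + α = lam' + β` with `α` supported below entries of
`lam` and `β` to the left of entries of `lam'`. If the claim fails at `(i, k)`, then `β_{ik} ≠ 0`,
so `lam'` has an entry at some `(i, l)` with `k < l`. There `lam` and `β` vanish, so `α_{il} ≠ 0`
and `lam` has an entry `(i', l)` with `i' < i`. By induction `lam'` has it too, giving two entries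
in column `l`. -/
theorem coEntry_eq_of_biact_eq [Finite F] (hP : P.IsNormal)
    {lam' : Module.Dual F (patternAlgebra F P)} (hlam : lam ∈ coSetPartitions F P)
    (hlam' : lam' ∈ coSetPartitions F P) (h : lam' ∈ biorbit (PosPoset.full n) lam)
    (i : Fin n) : ∀ k, coEntry lam i k ≠ 0 → coEntry lam i k = coEntry lam' i k := by
  obtain ⟨A, hA, B, hB, e⟩ := h
  obtain ⟨B', hB', hBB, -⟩ := exists_inv_lowerPattern hB
  have e' : biact A 1 lam = biact 1 B' lam' := by
    rw [e, biact_biact hP (one_mem_lowerPattern _) hB', hBB, one_mul]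
  have hα := biact_left_sub_mem (lam := lam) hA
  have hβ := biact_right_sub_mem (lam := lam') hB'
  set α := biact A 1 lam - lam with hα_def
  set β := biact 1 B' lam' - lam' with hβ_def
  have hsum : ∀ i k, coEntry lam i k + coEntry α i k = coEntry lam' i k + coEntry β i k := by
    intro i k
    rw [← coEntry_add, ← coEntry_add, hα_def, hβ_def, add_sub_cancel, add_sub_cancel, e']
  induction i using WellFoundedLT.induction with
  | ind i ih =>
    intro k hk
    by_contra hne
    have hα0 : coEntry α i k = 0 := by
      by_contra h'
      obtain ⟨-, i', hi', hlt⟩ := mem_coadjL.1 (hα (mem_coSupp.2 h'))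
      exact (show i' < i from hlt).ne (coSetPartitions_col hlam hi' hk)
    have hβ0 : coEntry β i k ≠ 0 := by
      intro h'
      have := hsum i k
      rw [hα0, h', add_zero, add_zero] at this
      exact hne this
    obtain ⟨-, l, hl, hkl⟩ := mem_coadjR.1 (hβ (mem_coSupp.2 hβ0))
    have hkl' : k < l := hkl
    have hil : coEntry lam i l = 0 := by
      by_contra h'
      exact hkl'.ne (coSetPartitions_row hlam hk h')
    have hβl : coEntry β i l = 0 := by
      by_contra h'
      obtain ⟨-, l', hl', hlt⟩ := mem_coadjR.1 (hβ (mem_coSupp.2 h'))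
      exact (show l < l' from hlt).ne (coSetPartitions_row hlam' hl hl')
    have hαl : coEntry α i l ≠ 0 := by
      have := hsum i l
      rw [hil, hβl, zero_add, add_zero] at this
      rwa [this]
    obtain ⟨-, i', hi', hlt⟩ := mem_coadjL.1 (hα (mem_coSupp.2 hαl))
    have hlt' : i' < i := hlt
    have h1 := ih i' hlt' l hi'
    rw [h1] at hi'
    exact hlt'.ne (coSetPartitions_col hlam' hi' hl)

/-- Distinct labeled set partitions lie in distinct two-sided orbits. -/
theorem coSetPartitions_eq_of_mem_biorbit [Finite F] (hP : P.IsNormal)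
    {lam' : Module.Dual F (patternAlgebra F P)} (hlam : lam ∈ coSetPartitions F P)
    (hlam' : lam' ∈ coSetPartitions F P) (h : lam' ∈ biorbit (PosPoset.full n) lam) :
    lam = lam' := by
  refine dual_ext fun i k _ => ?_
  by_cases hk : coEntry lam i k = 0
  · by_cases hk' : coEntry lam' i k = 0
    · rw [hk, hk']
    · exact (coEntry_eq_of_biact_eq hP hlam' hlam (mem_biorbit_symm hP h) i k hk').symm
  · exact coEntry_eq_of_biact_eq hP hlam hlam' h i k hk

/-- `coadjL P lam` is closed under moving down a column inside `P`, so the functionals supported on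
it are stable under left multiplication by the full group. -/
theorem coadjL_of_le (hP : P.IsNormal) {i j k : Fin n} (h : (i, k) ∈ coadjL P lam) (hij : i ≤ j)
    (hjk : (j, k) ∈ P.carrier) : (j, k) ∈ coadjL P lam := by
  obtain ⟨-, m, hm, hmi⟩ := mem_coadjL.1 h
  exact mem_coadjL.2 ⟨hjk, m, hm, hP.mem le_rfl hij hmi⟩

theorem coadjR_of_le (hP : P.IsNormal) {j k l : Fin n} (h : (j, l) ∈ coadjR P lam) (hkl : k ≤ l)
    (hjk : (j, k) ∈ P.carrier) : (j, k) ∈ coadjR P lam := by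
  obtain ⟨-, m, hm, hlm⟩ := mem_coadjR.1 h
  exact mem_coadjR.2 ⟨hjk, m, hm, hP.mem hkl le_rfl hlm⟩

theorem biact_left_mem_supportedIn (hP : P.IsNormal) {A : Matrix (Fin n) (Fin n) F}
    (hA : A ∈ lowerPattern F (PosPoset.full n)) {ν : Module.Dual F (patternAlgebra F P)}
    (hν : ν ∈ supportedIn F P (coadjL P lam)) : biact A 1 ν ∈ supportedIn F P (coadjL P lam) := by
  rw [supportedIn, Set.mem_ofPred_eq, coSupp_subset_iff]
  intro j k h
  have hjk := mem_of_coEntry_ne_zero h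
  rw [coEntry_biact_left _ hjk] at h
  obtain ⟨i, -, hi⟩ := Finset.exists_ne_zero_of_sum_ne_zero h
  exact coadjL_of_le hP (hν (mem_coSupp.2 (right_ne_zero_of_mul hi)))
    (le_of_lowerPattern hA (left_ne_zero_of_mul hi)) hjk

theorem biact_right_mem_supportedIn (hP : P.IsNormal) {B : Matrix (Fin n) (Fin n) F}
    (hB : B ∈ lowerPattern F (PosPoset.full n)) {ν : Module.Dual F (patternAlgebra F P)}
    (hν : ν ∈ supportedIn F P (coadjR P lam)) : biact 1 B ν ∈ supportedIn F P (coadjR P lam) := by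
  rw [supportedIn, Set.mem_ofPred_eq, coSupp_subset_iff]
  intro j k h
  have hjk := mem_of_coEntry_ne_zero h
  rw [coEntry_biact_right _ hjk] at h
  obtain ⟨i, -, hi⟩ := Finset.exists_ne_zero_of_sum_ne_zero h
  exact coadjR_of_le hP (hν (mem_coSupp.2 (left_ne_zero_of_mul hi)))
    (le_of_lowerPattern hB (right_ne_zero_of_mul hi)) hjk

/-- A partial converse to stability, by induction on the row. At a nonzero position outside `coadjL
P lam`, no higher entry of the column can contribute to `A ν`, since such an entry would lie in
`coadjL P lam` and drag the position into it. So `A ν` agrees with `ν` there. -/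
theorem mem_supportedIn_coadjL (hP : P.IsNormal) {A : Matrix (Fin n) (Fin n) F}
    (hA : A ∈ lowerPattern F (PosPoset.full n)) {ν : Module.Dual F (patternAlgebra F P)}
    (h : ∀ j k, coEntry ν j k ≠ 0 → (j, k) ∉ coadjL P lam → coEntry (biact A 1 ν) j k = 0) :
    ν ∈ supportedIn F P (coadjL P lam) := by
  rw [supportedIn, Set.mem_ofPred_eq, coSupp_subset_iff]
  intro j k
  induction j using WellFoundedLT.induction with
  | ind j ih =>
    intro hjk
    by_contra hn
    have hP' := mem_of_coEntry_ne_zero hjk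
    have := h j k hjk hn
    rw [coEntry_biact_left _ hP', Finset.sum_eq_single j, lowerPattern_apply_self hA,
      one_mul] at this
    · exact hjk this
    · intro i _ hij
      by_contra hne
      have hle := le_of_lowerPattern hA (left_ne_zero_of_mul hne)
      exact hn (coadjL_of_le hP (ih i (lt_of_le_of_ne hle hij) (right_ne_zero_of_mul hne)) hle hP')
    · simp

theorem mem_supportedIn_coadjR (hP : P.IsNormal) {B : Matrix (Fin n) (Fin n) F}
    (hB : B ∈ lowerPattern F (PosPoset.full n)) {ν : Module.Dual F (patternAlgebra F P)}
    (h : ∀ j k, coEntry ν j k ≠ 0 → (j, k) ∉ coadjR P lam → coEntry (biact 1 B ν) j k = 0) :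
    ν ∈ supportedIn F P (coadjR P lam) := by
  rw [supportedIn, Set.mem_ofPred_eq, coSupp_subset_iff]
  intro j k
  induction k using WellFoundedGT.induction with
  | ind k ih =>
    intro hjk
    by_contra hn
    have hP' := mem_of_coEntry_ne_zero hjk
    have := h j k hjk hn
    rw [coEntry_biact_right _ hP', Finset.sum_eq_single k, lowerPattern_apply_self hB,
      mul_one] at this
    · exact hjk this
    · intro i _ hij
      by_contra hne
      have hle := le_of_lowerPattern hB (right_ne_zero_of_mul hne)
      exact hn (coadjR_of_le hP
        (ih i (lt_of_le_of_ne hle hij.symm) (left_ne_zero_of_mul hne)) hle hP')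
    · simp

theorem biact_mul_left_sub_mem [Finite F] (hP : P.IsNormal) {A X : Matrix (Fin n) (Fin n) F}
    (hA : A ∈ lowerPattern F (PosPoset.full n)) (hX : X ∈ lowerPattern F P) :
    biact (X * A) 1 lam - biact A 1 lam ∈ supportedIn F P (coadjL P lam) := by
  obtain ⟨Y, hY, e⟩ := exists_mul_eq_mul_right hP hA hX
  have e' : biact (X * A) 1 lam - biact A 1 lam = biact A 1 (biact Y 1 lam - lam) := by
    rw [sub_eq_iff_eq_add', ← biact_add, add_sub_cancel,
      biact_biact hP hA (one_mem_lowerPattern _), e, one_mul]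
  rw [e']
  exact biact_left_mem_supportedIn hP hA (biact_left_sub_mem hY)

theorem biact_mul_right_sub_mem [Finite F] (hP : P.IsNormal) {B X : Matrix (Fin n) (Fin n) F}
    (hB : B ∈ lowerPattern F (PosPoset.full n)) (hX : X ∈ lowerPattern F P) :
    biact 1 (B * X) lam - biact 1 B lam ∈ supportedIn F P (coadjR P lam) := by
  obtain ⟨Y, hY, e⟩ := exists_mul_eq_mul_left hP hB hX
  have e' : biact 1 (B * X) lam - biact 1 B lam = biact 1 B (biact 1 Y lam - lam) := by
    rw [sub_eq_iff_eq_add', ← biact_add, add_sub_cancel,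
      biact_biact hP (one_mem_lowerPattern _) hB, e, one_mul]
  rw [e']
  exact biact_right_mem_supportedIn hP hB (biact_right_sub_mem hY)

/-- Here the asymmetric splitting of `η` matters: off `coadj P lam`, a position of the full `coadjL`
lies in `coauxL`, which is removed from the right-hand part. -/
theorem coEntry_coRestrict_coauxR_eq_zero {η : Module.Dual F (patternAlgebra F P)}
    (hη : coSupp η ⊆ coaux P lam) {j k : Fin n} (h : (j, k) ∈ coadjL (PosPoset.full n) lam) :
    coEntry (coRestrict (coauxR P lam \ coauxL P lam) η) j k = 0 := by
  by_contra hne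
  have h' : (j, k) ∈ coauxR P lam \ coauxL P lam :=
    coSupp_coRestrict_subset _ _ (mem_coSupp.2 hne)
  rw [coEntry_coRestrict, if_pos h'] at hne
  exact h'.2 ⟨h, fun hL => (hη (mem_coSupp.2 hne)).2 (Or.inl hL)⟩

theorem coEntry_eq_zero_of_mem_coadj {η : Module.Dual F (patternAlgebra F P)}
    (hη : coSupp η ⊆ coaux P lam) {j k : Fin n} (h : (j, k) ∈ coadj P lam) :
    coEntry η j k = 0 :=
  coEntry_eq_zero_of_coSupp_subset hη fun hx => hx.2 h

theorem coaux_subset_union : coaux P lam ⊆ coauxL P lam ∪ coauxR P lam := by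
  rintro p ⟨hp | hp, hp'⟩
  · exact Or.inl ⟨hp, fun h => hp' (Or.inl h)⟩
  · exact Or.inr ⟨hp, fun h => hp' (Or.inr h)⟩

/-- The functionals `lam + coRep lam η` lie in distinct two-sided `P`-orbits. -/
theorem eq_of_add_coRep_mem_biorbit [Finite F] (hP : P.IsNormal)
    (hlam : lam ∈ coSetPartitions F P) {η η' : Module.Dual F (patternAlgebra F P)}
    (hη : coSupp η ⊆ coaux P lam) (hη' : coSupp η' ⊆ coaux P lam)
    (h : lam + coRep lam η' ∈ biorbit P (lam + coRep lam η)) : η = η' := by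
  classical
  obtain ⟨A, hA, B, hB, eA, eB, eAB⟩ := exists_biact_eq_add_coRep hP hlam η
  obtain ⟨A', hA', B', hB', eA', eB', eAB'⟩ := exists_biact_eq_add_coRep hP hlam η'
  obtain ⟨X, hX, Y, hY, e⟩ := h
  obtain ⟨Ai, hAi, hAAi, hAiA⟩ := exists_inv_lowerPattern hA'
  obtain ⟨Bi, hBi, hBBi, hBiB⟩ := exists_inv_lowerPattern hB
  obtain ⟨Yi, hYi, hYYi, -⟩ := exists_inv_lowerPattern hY
  have hX' := lowerPattern_mono hX
  have hYi' := lowerPattern_mono hYi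
  have h1 := one_mem_lowerPattern (F := F) (PosPoset.full n)
  rw [← eAB, ← eAB', biact_biact hP hX' (lowerPattern_mono hY)] at e
  have hC : Ai * (X * A) ∈ lowerPattern F (PosPoset.full n) :=
    mul_mem_lowerPattern hAi (mul_mem_lowerPattern hX' hA)
  have hD : B' * (Yi * Bi) ∈ lowerPattern F (PosPoset.full n) :=
    mul_mem_lowerPattern hB' (mul_mem_lowerPattern hYi' hBi)
  -- From `X A lam B Y = A' lam B'`, gather the left factors on one side and the right factors on
  -- the other. The common value `lam + ν` lies in both the left and the right full orbit of `lam`.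
  have e2 : biact (Ai * (X * A)) 1 lam = biact 1 (B' * (Yi * Bi)) lam := by
    have := congrArg (biact Ai (Yi * Bi)) e
    rw [biact_biact hP hAi (mul_mem_lowerPattern hYi' hBi),
      biact_biact hP hAi (mul_mem_lowerPattern hYi' hBi), hAiA] at this
    rw [this]
    congr 1
    calc (1 : Matrix (Fin n) (Fin n) F) = B * ((Y * Yi) * Bi) := by rw [hYYi, one_mul, hBBi]
      _ = B * Y * (Yi * Bi) := by simp only [mul_assoc]
  have hνL := biact_left_sub_mem (lam := lam) hC
  set ν := biact (Ai * (X * A)) 1 lam - lam with hν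
  have e3 : lam + ν = biact (Ai * (X * A)) 1 lam := add_sub_cancel _ _
  have haL := biact_mul_left_sub_mem (lam := lam) hP hA hX
  have hbR := biact_mul_right_sub_mem (lam := lam) hP hB' hYi
  set a := biact (X * A) 1 lam - biact A 1 lam with ha
  set b := biact 1 (B' * Yi) lam - biact 1 B' lam with hb
  have eL : biact A' 1 ν =
      coRestrict (coauxL P lam) η + a - coRestrict (coauxL P lam) η' := by
    have h2 : biact A' 1 (lam + ν) = biact (X * A) 1 lam := by
      rw [e3, biact_biact hP hA' h1, ← mul_assoc, hAAi, one_mul, one_mul]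
    rw [biact_add, eA', show biact (X * A) 1 lam = biact A 1 lam + a from
      (add_sub_cancel _ _).symm, eA, add_assoc, add_assoc, add_right_inj] at h2
    rw [← h2, add_sub_cancel_left]
  have eR : biact 1 B ν = coRestrict (coauxR P lam \ coauxL P lam) η' + b -
      coRestrict (coauxR P lam \ coauxL P lam) η := by
    have h2 : biact 1 B (lam + ν) = biact 1 (B' * Yi) lam := by
      rw [e3, e2, biact_biact hP h1 hB, one_mul, mul_assoc, mul_assoc, hBiB, mul_one]
    rw [biact_add, eB, show biact 1 (B' * Yi) lam = biact 1 B' lam + b from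
      (add_sub_cancel _ _).symm, eB', add_assoc, add_assoc, add_right_inj] at h2
    rw [← h2, add_sub_cancel_left]
  -- The support of `ν` lies in the full `coadjL`, where the right-hand parts of `η` and `η'`
  -- vanish; by `eR` only `b` remains.
  have hνR : ν ∈ supportedIn F P (coadjR P lam) := by
    refine mem_supportedIn_coadjR hP hB fun j k hjk hn => ?_
    have hL := hνL (mem_coSupp.2 hjk)
    rw [eR, coEntry_sub, coEntry_add, coEntry_coRestrict_coauxR_eq_zero hη hL,
      coEntry_coRestrict_coauxR_eq_zero hη' hL, coEntry_eq_zero_of_coSupp_subset hbR hn]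
    simp
  -- Now the support of `ν` lies in `coadj P lam`, where `η` and `η'` vanish; by `eL` only `a`
  -- remains.
  have hνL' : ν ∈ supportedIn F P (coadjL P lam) := by
    refine mem_supportedIn_coadjL hP hA' fun j k hjk hn => ?_
    have hR : (j, k) ∈ coadj P lam := Or.inr (hνR (mem_coSupp.2 hjk))
    rw [eL, coEntry_sub, coEntry_add, coEntry_coRestrict, coEntry_coRestrict,
      coEntry_eq_zero_of_mem_coadj hη hR, coEntry_eq_zero_of_mem_coadj hη' hR,
      coEntry_eq_zero_of_coSupp_subset haL hn]
    simp
  have hBν := biact_right_mem_supportedIn hP hB hνR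
  have hAν := biact_left_mem_supportedIn hP hA' hνL'
  -- On `coauxL` the terms `A' ν` and `a` of `eL` vanish, so `η` and `η'` agree; `eR` does the same
  -- on the rest of `coauxR`.
  refine dual_ext fun j k _ => ?_
  by_cases hcL : (j, k) ∈ coauxL P lam
  · have := congrArg (fun x => coEntry x j k) eL
    simp only [coEntry_sub, coEntry_add, coEntry_coRestrict, if_pos hcL,
      coEntry_eq_zero_of_coSupp_subset haL hcL.2, coEntry_eq_zero_of_coSupp_subset hAν hcL.2,
      add_zero] at this
    exact sub_eq_zero.1 this.symm
  by_cases hcR : (j, k) ∈ coauxR P lam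
  · have hc : (j, k) ∈ coauxR P lam \ coauxL P lam := ⟨hcR, hcL⟩
    have := congrArg (fun x => coEntry x j k) eR
    simp only [coEntry_sub, coEntry_add, coEntry_coRestrict, if_pos hc,
      coEntry_eq_zero_of_coSupp_subset hbR hcR.2, coEntry_eq_zero_of_coSupp_subset hBν hcR.2,
      add_zero] at this
    exact (sub_eq_zero.1 this.symm).symm
  · have hn : (j, k) ∉ coaux P lam := fun hx => (coaux_subset_union hx).elim hcL hcR
    rw [coEntry_eq_zero_of_coSupp_subset hη hn, coEntry_eq_zero_of_coSupp_subset hη' hn]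

theorem ncard_coadj_full (lam : Module.Dual F (patternAlgebra F P)) :
    (coaux P lam).ncard + (coadj P lam).ncard = (coadj (PosPoset.full n) lam).ncard := by
  refine Set.ncard_sdiff_add_ncard_of_subset ?_
  rintro p (⟨hp, i, hi, h⟩ | ⟨hp, i, hi, h⟩)
  · exact Or.inl ⟨hp, i, hi, P.lt_of_mem h⟩
  · exact Or.inr ⟨hp, i, hi, P.lt_of_mem h⟩

theorem coaux_subset_carrier (lam : Module.Dual F (patternAlgebra F P)) :
    coaux P lam ⊆ P.carrier :=
  Set.sdiff_subset.trans (coadj_subset _)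

theorem add_coRep_mem_biorbit_full (hP : P.IsNormal)
    (hlam : lam ∈ coSetPartitions F P) (η : Module.Dual F (patternAlgebra F P)) :
    lam + coRep lam η ∈ biorbit (PosPoset.full n) lam := by
  obtain ⟨A, hA, B, hB, -, -, e⟩ := exists_biact_eq_add_coRep hP hlam η
  exact ⟨A, hA, B, hB, e.symm⟩

end Representatives

/-! ### Reduction to a labeled set partition -/

section Elimination

open Matrix

variable {F : Type*} [Field F] {n : ℕ} {P : PosPoset n}

/-- Every nonzero entry in the first `r` rows is the only nonzero entry in its row and column. -/
def IsReducedAbove (r : ℕ) (x : Module.Dual F (patternAlgebra F P)) : Prop :=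
  ∀ i k : Fin n, i.val < r → coEntry x i k ≠ 0 →
    (∀ l, coEntry x i l ≠ 0 → l = k) ∧ ∀ j, coEntry x j k ≠ 0 → j = i

theorem exists_isReducedAbove_succ (hP : P.IsNormal) {x : Module.Dual F (patternAlgebra F P)}
    {R : Fin n} (hx : IsReducedAbove R.val x) :
    ∃ y ∈ biorbit (PosPoset.full n) x, IsReducedAbove (R.val + 1) y := by
  classical
  by_cases hrow : ∀ k, coEntry x R k = 0
  · refine ⟨x, self_mem_biorbit _ x, fun i k hi hik => ?_⟩
    rcases Nat.lt_succ_iff_lt_or_eq.1 hi with hi | hi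
    · exact hx i k hi hik
    · rw [Fin.ext hi] at hik
      exact absurd (hrow k) hik
  push Not at hrow
  -- The pivot is the rightmost nonzero entry of row `R`: the permitted column operations add a
  -- column only to columns on its left, and row operations add a row only to rows below.
  obtain ⟨k, hk, hmax⟩ : ∃ k, coEntry x R k ≠ 0 ∧ ∀ l, k < l → coEntry x R l = 0 := by
    obtain ⟨k, hk⟩ := (Set.toFinite {k | coEntry x R k ≠ 0}).exists_maximal hrow
    refine ⟨k, hk.1, fun l hl => ?_⟩
    by_contra h
    exact hl.not_ge (hk.2 h hl.le)
  have hk_above : ∀ i, i < R → coEntry x i k = 0 := by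
    intro i hi
    by_contra h
    exact hi.ne' ((hx i k hi h).2 R hk)
  -- `B` clears row `R` to the left of the pivot; afterwards `A` clears column `k` below it.
  let B : Matrix (Fin n) (Fin n) F := Matrix.of fun l m =>
    if l = m then 1 else if l = k ∧ m < k then -coEntry x R m / coEntry x R k else 0
  let A : Matrix (Fin n) (Fin n) F := Matrix.of fun j i =>
    if j = i then 1 else if i = R ∧ R < j then -coEntry x j k / coEntry x R k else 0
  have hB : B ∈ lowerPattern F (PosPoset.full n) := by
    refine mem_lowerPattern_of (fun i => by simp [B]) fun l m hlm h => ?_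
    by_contra hn
    have : ¬ (l = k ∧ m < k) := fun h' => hn (h'.1 ▸ h'.2)
    simp [B, hlm, this] at h
  have hA : A ∈ lowerPattern F (PosPoset.full n) := by
    refine mem_lowerPattern_of (fun i => by simp [A]) fun j i hij h => ?_
    by_contra hn
    have : ¬ (i = R ∧ R < j) := fun h' => hn (h'.1 ▸ h'.2)
    simp [A, hij, this] at h
  set z := biact 1 B x with hz
  have hz_entry : ∀ j m, (j, m) ∈ P.carrier → coEntry z j m =
      coEntry x j m + if m < k then coEntry x j k * (-coEntry x R m / coEntry x R k) else 0 := by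
    intro j m hjm
    rw [hz, coEntry_biact_right _ hjm, ← Finset.add_sum_erase _ _ (Finset.mem_univ m),
      lowerPattern_apply_self hB, mul_one]
    congr 1
    split_ifs with hm
    · rw [Finset.sum_eq_single k]
      · simp [B, hm, hm.ne']
      · intro l hl hlk
        simp [B, Finset.ne_of_mem_erase hl, hlk]
      · intro h
        exact absurd (Finset.mem_erase.2 ⟨hm.ne', Finset.mem_univ _⟩) h
    · refine Finset.sum_eq_zero fun l hl => ?_
      simp [B, Finset.ne_of_mem_erase hl, hm]
  have hz_above : ∀ i m, i < R → coEntry z i m = coEntry x i m := by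
    intro i m hi
    by_cases hP' : (i, m) ∈ P.carrier
    · rw [hz_entry i m hP', hk_above i hi]
      simp
    · rw [coEntry_of_notMem _ hP', coEntry_of_notMem _ hP']
  have hz_col : ∀ j, coEntry z j k = coEntry x j k := by
    intro j
    by_cases hP' : (j, k) ∈ P.carrier
    · rw [hz_entry j k hP']
      simp
    · rw [coEntry_of_notMem _ hP', coEntry_of_notMem _ hP']
  have hz_row : ∀ m, m ≠ k → coEntry z R m = 0 := by
    intro m hm
    by_cases hP' : (R, m) ∈ P.carrier
    · rw [hz_entry R m hP']
      rcases lt_or_gt_of_ne hm with h | h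
      · rw [if_pos h]
        field_simp
        ring
      · rw [if_neg h.le.not_gt, hmax m h, add_zero]
    · exact coEntry_of_notMem _ hP'
  set y := biact A 1 z with hy
  have hy_entry : ∀ j m, (j, m) ∈ P.carrier → coEntry y j m =
      coEntry z j m + if R < j then -coEntry x j k / coEntry x R k * coEntry z R m else 0 := by
    intro j m hjm
    rw [hy, coEntry_biact_left _ hjm, ← Finset.add_sum_erase _ _ (Finset.mem_univ j),
      lowerPattern_apply_self hA, one_mul]
    congr 1
    split_ifs with hj
    · rw [Finset.sum_eq_single R]
      · simp [A, hj, hj.ne']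
      · intro l hl hlk
        simp [A, (Finset.ne_of_mem_erase hl).symm, hlk]
      · intro h
        exact absurd (Finset.mem_erase.2 ⟨hj.ne, Finset.mem_univ _⟩) h
    · refine Finset.sum_eq_zero fun l hl => ?_
      simp [A, (Finset.ne_of_mem_erase hl).symm, hj]
  -- Row `R` is already zero away from the pivot, so the row operation changes column `k` only.
  have hy_ne : ∀ j m, m ≠ k → coEntry y j m = coEntry z j m := by
    intro j m hm
    by_cases hP' : (j, m) ∈ P.carrier
    · rw [hy_entry j m hP', hz_row m hm]
      simp
    · rw [coEntry_of_notMem _ hP', coEntry_of_notMem _ hP']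
  have hy_le : ∀ j m, j ≤ R → coEntry y j m = coEntry z j m := by
    intro j m hj
    by_cases hP' : (j, m) ∈ P.carrier
    · rw [hy_entry j m hP', if_neg hj.not_gt, add_zero]
    · rw [coEntry_of_notMem _ hP', coEntry_of_notMem _ hP']
  have hy_below : ∀ j, R < j → coEntry y j k = 0 := by
    intro j hj
    by_cases hP' : (j, k) ∈ P.carrier
    · rw [hy_entry j k hP', if_pos hj, hz_col, hz_col]
      field_simp
      ring
    · exact coEntry_of_notMem _ hP'
  have hy_above : ∀ i m, i < R → coEntry y i m = coEntry x i m := fun i m hi => by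
    rw [hy_le i m hi.le, hz_above i m hi]
  refine ⟨y, ⟨A, hA, B, hB, ?_⟩, fun i m hi him => ?_⟩
  · rw [hy, hz, biact_left_right hP hA]
  rcases Nat.lt_succ_iff_lt_or_eq.1 hi with hi | hi
  · have hiR : i < R := hi
    rw [hy_above i m hiR] at him
    obtain ⟨h₁, h₂⟩ := hx i m hi him
    refine ⟨fun l hl => h₁ l (by rwa [hy_above i l hiR] at hl), fun j hj => ?_⟩
    have hmk : m ≠ k := by
      rintro rfl
      exact him (hk_above i hiR)
    -- Column `m` already has its sole entry in row `i`, so its multiplier in `B` is zero and the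
    -- column operation leaves it alone.
    have hRm : coEntry x R m = 0 := by
      by_contra h'
      exact hiR.ne' (h₂ R h')
    rw [hy_ne j m hmk, hz_entry j m (by
      have := mem_of_coEntry_ne_zero hj
      exact this), hRm] at hj
    exact h₂ j (by simpa using hj)
  · obtain rfl : i = R := Fin.ext hi
    obtain rfl : m = k := by
      by_contra hmk
      rw [hy_ne _ _ hmk] at him
      exact him (hz_row m hmk)
    refine ⟨fun l hl => ?_, fun j hj => ?_⟩
    · by_contra hlk
      rw [hy_ne _ _ hlk] at hl
      exact hl (hz_row l hlk)
    · rcases lt_trichotomy j i with h | h | h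
      · rw [hy_above j _ h] at hj
        exact absurd (hk_above j h) hj
      · exact h
      · exact absurd (hy_below j h) hj

/-- Every functional lies in the two-sided orbit of a labeled set partition. -/
theorem exists_coSetPartitions_mem_biorbit [Finite F] (hP : P.IsNormal)
    (x : Module.Dual F (patternAlgebra F P)) :
    ∃ lam ∈ coSetPartitions F P, x ∈ biorbit (PosPoset.full n) lam := by
  have key : ∀ r ≤ n, ∃ y ∈ biorbit (PosPoset.full n) x, IsReducedAbove r y := by
    intro r
    induction r with
    | zero => exact fun _ => ⟨x, self_mem_biorbit _ x, fun i k hi => absurd hi (Nat.not_lt_zero _)⟩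
    | succ r ih =>
      intro hr
      obtain ⟨y, hy, hy'⟩ := ih (Nat.le_of_succ_le hr)
      obtain ⟨w, hw, hw'⟩ := exists_isReducedAbove_succ hP (R := ⟨r, hr⟩) hy'
      exact ⟨w, mem_biorbit_trans hP hy hw, hw'⟩
  obtain ⟨y, hy, hy'⟩ := key n le_rfl
  refine ⟨y, ?_, mem_biorbit_symm hP hy⟩
  rintro ⟨i, k⟩ hp ⟨j, l⟩ hr (h | h)
  · obtain rfl : i = j := h
    rw [(hy' i k i.2 hp.2).1 l hr.2]
  · obtain rfl : k = l := h
    rw [(hy' i k i.2 hp.2).2 j hr.2]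

end Elimination

/-! ### Orthogonality and supercharacters -/

section Characters

variable {F : Type*} [Field F] [Finite F] {n : ℕ} {P : PosPoset n}

theorem patternSubOne_bijective : Function.Bijective (patternSubOne (F := F) (P := P)) := by
  constructor
  · intro g h e
    have e' : patternMatrix g - 1 = patternMatrix h - 1 := congrArg Subtype.val e
    exact Subtype.ext (Units.ext (sub_left_inj.1 e'))
  · intro X
    obtain ⟨g, hg⟩ := exists_patternGroup_of_isPatternUnipotent (Q := P)
      (M := (X : Matrix (Fin n) (Fin n) F) + 1)
      (isPatternUnipotent_iff.2 (by simp))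
    exact ⟨g, Subtype.ext (by simp [patternSubOne, hg])⟩

/-- The map `g ↦ g - 1` is a bijection onto `𝔫_P`, and a nonzero functional is onto `F`, so this is
the sum of a nontrivial additive character over `𝔫_P`. -/
theorem sum_addChar_dual_eq_zero {θ : AddChar F ℂ} (hθ : θ ≠ 1)
    {ρ : Module.Dual F (patternAlgebra F P)} (hρ : ρ ≠ 0) :
    ∑ g, θ (ρ (patternSubOne g)) = 0 := by
  classical
  have : Fintype (patternAlgebra F P) := Fintype.ofFinite _
  rw [Function.Bijective.sum_comp patternSubOne_bijective fun X => θ (ρ X)]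
  refine AddChar.sum_eq_zero_of_ne_one (ψ := θ.compAddMonoidHom ρ.toAddMonoidHom) fun h => hθ ?_
  obtain ⟨X, hX⟩ : ∃ X, ρ X ≠ 0 := by
    by_contra! h'
    exact hρ (LinearMap.ext h')
  ext a
  have := DFunLike.congr_fun h ((a / ρ X) • X)
  simpa [hX] using this

/-- The linear character `g ↦ θ (mu (g - 1))`, as a function on `U_P`. -/
noncomputable def dualChar (θ : AddChar F ℂ) (mu : Module.Dual F (patternAlgebra F P)) :
    patternGroup F P → ℂ :=
  fun g => θ (mu (patternSubOne g))

theorem patternInner_dualChar {θ : AddChar F ℂ} (hθ : θ ≠ 1)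
    [DecidableEq (Module.Dual F (patternAlgebra F P))]
    (mu nu : Module.Dual F (patternAlgebra F P)) :
    patternInner (dualChar θ mu) (dualChar θ nu) = if mu = nu then 1 else 0 := by
  have e : ∀ g, dualChar θ mu g * (starRingEnd ℂ) (dualChar θ nu g) =
      θ ((mu - nu) (patternSubOne g)) := by
    intro g
    rw [dualChar, dualChar, ← AddChar.map_neg_eq_conj, ← AddChar.map_add_eq_mul,
      LinearMap.sub_apply, sub_eq_add_neg]
  rw [patternInner, Finset.sum_congr rfl fun g _ => e g]
  split_ifs with h
  · subst h
    simp
  · rw [sum_addChar_dual_eq_zero hθ (sub_ne_zero.2 h), mul_zero]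

theorem patternInner_smul_sum_left {ι : Type*} (s : Finset ι) (c : ℂ)
    (f : ι → patternGroup F P → ℂ) (ψ : patternGroup F P → ℂ) :
    patternInner (fun g => c * ∑ i ∈ s, f i g) ψ = c * ∑ i ∈ s, patternInner (f i) ψ := by
  simp only [patternInner, Finset.mul_sum, Finset.sum_mul]
  rw [Finset.sum_comm]
  exact Finset.sum_congr rfl fun i _ => Finset.sum_congr rfl fun g _ => by ring

theorem patternInner_conj_symm (χ ψ : patternGroup F P → ℂ) :
    (starRingEnd ℂ) (patternInner χ ψ) = patternInner ψ χ := by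
  simp only [patternInner, map_mul, map_sum, map_div₀, map_one, Complex.conj_conj,
    Complex.conj_natCast]
  exact congrArg _ (Finset.sum_congr rfl fun g _ => mul_comm _ _)

theorem superchar_eq (hP : P.IsNormal) (θ : AddChar F ℂ)
    (lam : Module.Dual F (patternAlgebra F P)) :
    superchar θ lam = fun g => ((leftOrbit P lam).ncard : ℂ) / ((biorbit P lam).ncard : ℂ) *
      ∑ mu ∈ (Set.toFinite (biorbit P lam)).toFinset, dualChar θ mu g := by
  funext g
  simp only [superchar, leftCoorbit_eq, twoSidedCoorbit_eq hP]
  rfl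

theorem ncard_leftOrbit_ne_zero (lam : Module.Dual F (patternAlgebra F P)) :
    ((leftOrbit P lam).ncard : ℂ) ≠ 0 := by
  have h : (leftOrbit P lam).ncard ≠ 0 := Set.ncard_ne_zero_of_mem
    (a := lam) ⟨1, one_mem_lowerPattern P, (biact_one_one lam).symm⟩
  exact_mod_cast h

theorem ncard_biorbit_ne_zero (lam : Module.Dual F (patternAlgebra F P)) :
    ((biorbit P lam).ncard : ℂ) ≠ 0 := by
  have h : (biorbit P lam).ncard ≠ 0 := Set.ncard_ne_zero_of_mem (self_mem_biorbit P lam)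
  exact_mod_cast h

open Classical in
theorem patternInner_superchar_dualChar (hP : P.IsNormal) {θ : AddChar F ℂ} (hθ : θ ≠ 1)
    (lam nu : Module.Dual F (patternAlgebra F P)) :
    patternInner (superchar θ lam) (dualChar θ nu) = if nu ∈ biorbit P lam then
      ((leftOrbit P lam).ncard : ℂ) / ((biorbit P lam).ncard : ℂ) else 0 := by
  rw [superchar_eq hP, patternInner_smul_sum_left]
  simp only [patternInner_dualChar hθ, Finset.sum_ite_eq', Set.Finite.mem_toFinset]
  split_ifs <;> simp

/-- The coefficients of a supercharacter in the orthonormal family `dualChar` are nonzero exactly on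
its two-sided orbit, so the function remembers the orbit. Conversely, left orbits within one
two-sided orbit have equal size, so the normalizing factor depends on the orbit alone. -/
theorem superchar_eq_superchar_iff (hP : P.IsNormal) {θ : AddChar F ℂ} (hθ : θ ≠ 1)
    {lam mu : Module.Dual F (patternAlgebra F P)} :
    superchar θ lam = superchar θ mu ↔ mu ∈ biorbit P lam := by
  constructor
  · intro h
    by_contra hn
    have h₁ := patternInner_superchar_dualChar hP hθ lam mu
    rw [h, patternInner_superchar_dualChar hP hθ mu mu, if_pos (self_mem_biorbit P mu),
      if_neg hn] at h₁
    exact div_ne_zero (ncard_leftOrbit_ne_zero mu) (ncard_biorbit_ne_zero mu) h₁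
  · intro h
    have e : (leftOrbit P mu).ncard = (leftOrbit P lam).ncard := by
      obtain ⟨A, hA, B, hB, rfl⟩ := h
      exact ncard_leftOrbit_biact hP (lowerPattern_mono hA) (lowerPattern_mono hB) lam
    rw [superchar_eq hP, superchar_eq hP, e]
    simp only [biorbit_eq_of_mem hP h]

theorem superchar_one (hP : P.IsNormal) (θ : AddChar F ℂ)
    (lam : Module.Dual F (patternAlgebra F P)) :
    superchar θ lam 1 = (leftOrbit P lam).ncard := by
  have h1 : patternSubOne (1 : patternGroup F P) = 0 :=
    Subtype.ext (by simp [patternSubOne, patternMatrix])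
  rw [superchar_eq hP]
  simp only [dualChar, h1, map_zero, AddChar.map_zero_eq_one, Finset.sum_const, nsmul_eq_mul,
    mul_one]
  rw [← Set.ncard_eq_toFinset_card, div_mul_cancel₀ _ (ncard_biorbit_ne_zero lam)]

/-- All |two-sided orbit| coefficients equal |left orbit| / |two-sided orbit|, and the norm is the
sum of their squares. -/
theorem patternInner_superchar_self (hP : P.IsNormal) {θ : AddChar F ℂ} (hθ : θ ≠ 1)
    (lam : Module.Dual F (patternAlgebra F P)) :
    patternInner (superchar θ lam) (superchar θ lam) =
      ((leftOrbit P lam).ncard : ℂ) ^ 2 / ((biorbit P lam).ncard : ℂ) := by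
  classical
  conv_lhs =>
    arg 1
    rw [superchar_eq hP]
  rw [patternInner_smul_sum_left]
  have h : ∀ mu ∈ (Set.toFinite (biorbit P lam)).toFinset,
      patternInner (dualChar θ mu) (superchar θ lam) =
        ((leftOrbit P lam).ncard : ℂ) / ((biorbit P lam).ncard : ℂ) := by
    intro mu hmu
    rw [← patternInner_conj_symm, patternInner_superchar_dualChar hP hθ,
      if_pos ((Set.Finite.mem_toFinset _).1 hmu), map_div₀, Complex.conj_natCast,
      Complex.conj_natCast]
  have hne := ncard_biorbit_ne_zero lam
  rw [Finset.sum_congr rfl h, Finset.sum_const, ← Set.ncard_eq_toFinset_card, nsmul_eq_mul]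
  field_simp

theorem ncard_biorbit_add_coRep (hP : P.IsNormal) {lam : Module.Dual F (patternAlgebra F P)}
    (hlam : lam ∈ coSetPartitions F P) (η : Module.Dual F (patternAlgebra F P)) :
    (biorbit P (lam + coRep lam η)).ncard = Nat.card F ^ (coadj P lam).ncard := by
  obtain ⟨A, hA, B, hB, -, -, e⟩ := exists_biact_eq_add_coRep hP hlam η
  rw [← e, ncard_biorbit_biact hP hA hB, ncard_biorbit hP hlam]

theorem ncard_leftOrbit_add_coRep (hP : P.IsNormal) {lam : Module.Dual F (patternAlgebra F P)}
    (hlam : lam ∈ coSetPartitions F P) (η : Module.Dual F (patternAlgebra F P)) :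
    (leftOrbit P (lam + coRep lam η)).ncard = Nat.card F ^ (coadjL P lam).ncard := by
  obtain ⟨A, hA, B, hB, -, -, e⟩ := exists_biact_eq_add_coRep hP hlam η
  rw [← e, ncard_leftOrbit_biact hP hA hB, ncard_leftOrbit hlam]

/-- Every functional lies in the two-sided `P`-orbit of some `lam + coRep lam η`. -/
theorem exists_mem_biorbit_add_coRep (hP : P.IsNormal)
    {lam x : Module.Dual F (patternAlgebra F P)} (hlam : lam ∈ coSetPartitions F P)
    (hx : x ∈ biorbit (PosPoset.full n) lam) :
    ∃ η, coSupp η ⊆ coaux P lam ∧ x ∈ biorbit P (lam + coRep lam η) := by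
  classical
  let s := (Set.toFinite (supportedIn F P (coaux P lam))).toFinset
  let t := fun η => (Set.toFinite (biorbit P (lam + coRep lam η))).toFinset
  have hs : ∀ η, η ∈ s ↔ coSupp η ⊆ coaux P lam := fun η => Set.Finite.mem_toFinset _
  have ht : ∀ η y, y ∈ t η ↔ y ∈ biorbit P (lam + coRep lam η) :=
    fun η y => Set.Finite.mem_toFinset _
  have hdisj : ∀ η ∈ s, ∀ η' ∈ s, η ≠ η' → Disjoint (t η) (t η') := by
    intro η hη η' hη' hne
    rw [Finset.disjoint_left]
    intro y hy hy'
    rw [ht] at hy hy'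
    exact hne (eq_of_add_coRep_mem_biorbit hP hlam ((hs η).1 hη) ((hs η').1 hη')
      (mem_biorbit_trans hP hy (mem_biorbit_symm hP hy')))
  -- The disjoint `P`-orbits total `q ^ |coaux| * q ^ |coadj_P|` elements, which is the size of the
  -- full orbit containing them.
  have hcard : (s.biUnion t).card = (biorbit (PosPoset.full n) lam).ncard := by
    rw [Finset.card_biUnion hdisj, Finset.sum_const_nat
      (m := Nat.card F ^ (coadj P lam).ncard), ncard_biorbit hP hlam, ← ncard_coadj_full, pow_add,
      ← Set.ncard_eq_toFinset_card, ncard_supportedIn (coaux_subset_carrier lam)]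
    intro η _
    rw [← Set.ncard_eq_toFinset_card, ncard_biorbit_add_coRep hP hlam]
  have hsub : s.biUnion t ⊆ (Set.toFinite (biorbit (PosPoset.full n) lam)).toFinset := by
    intro y hy
    obtain ⟨η, -, hy⟩ := Finset.mem_biUnion.1 hy
    rw [Set.Finite.mem_toFinset]
    exact mem_biorbit_trans hP (add_coRep_mem_biorbit_full hP hlam η)
      (biorbit_mono _ ((ht η y).1 hy))
  have heq := Finset.eq_of_subset_of_card_le hsub
    (by rw [hcard, ← Set.ncard_eq_toFinset_card])
  have hx' : x ∈ s.biUnion t := by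
    rw [heq, Set.Finite.mem_toFinset]
    exact hx
  obtain ⟨η, hη, hx'⟩ := Finset.mem_biUnion.1 hx'
  exact ⟨η, (hs η).1 hη, (ht η x).1 hx'⟩

end Characters

theorem mainTheorem1 {F : Type*} [Field F] [Finite F] {n : ℕ} (θ : AddChar F ℂ) (hθ : θ ≠ 1)
    (P : PosPoset n) (hP : P.IsNormal) :
    Set.BijOn
      (fun p : Module.Dual F (patternAlgebra F P) × Module.Dual F (patternAlgebra F P) =>
        pairSuperchar θ p.1 p.2)
      {p | p.1 ∈ coSetPartitions F P ∧ coSupp p.2 ⊆ coaux P p.1}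
      (supercharacters θ P) ∧
    ∀ lam ∈ coSetPartitions F P, ∀ η : Module.Dual F (patternAlgebra F P),
      coSupp η ⊆ coaux P lam →
        pairSuperchar θ lam η 1 = (Nat.card F : ℂ) ^ (coadjL P lam).ncard ∧
        pairSuperchar θ lam η 1 = (Nat.card F : ℂ) ^ (coadjR P lam).ncard ∧
        patternInner (pairSuperchar θ lam η) (pairSuperchar θ lam η) =
          (Nat.card F : ℂ) ^ (coadjL P lam ∩ coadjR P lam).ncard := by
  refine ⟨⟨fun p _ => ⟨_, rfl⟩, ?_, ?_⟩, ?_⟩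
  · rintro ⟨lam, η⟩ ⟨hlam, hη⟩ ⟨lam', η'⟩ ⟨hlam', hη'⟩ h
    have h' := (superchar_eq_superchar_iff hP hθ).1 h
    -- Equal supercharacters share a `P`-orbit, hence a full orbit, and the full orbit determines
    -- `lam`.
    obtain rfl : lam = lam' := coSetPartitions_eq_of_mem_biorbit hP hlam hlam'
      (mem_biorbit_trans hP (mem_biorbit_trans hP (add_coRep_mem_biorbit_full hP hlam η)
        (biorbit_mono _ h')) (mem_biorbit_symm hP (add_coRep_mem_biorbit_full hP hlam' η')))
    exact Prod.ext rfl (eq_of_add_coRep_mem_biorbit hP hlam hη hη' h')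
  · rintro _ ⟨x, rfl⟩
    obtain ⟨lam, hlam, hx⟩ := exists_coSetPartitions_mem_biorbit hP x
    obtain ⟨η, hη, hx'⟩ := exists_mem_biorbit_add_coRep hP hlam hx
    exact ⟨(lam, η), ⟨hlam, hη⟩, (superchar_eq_superchar_iff hP hθ).2 hx'⟩
  · intro lam hlam η _
    have h1 : pairSuperchar θ lam η 1 = (Nat.card F : ℂ) ^ (coadjL P lam).ncard := by
      rw [pairSuperchar, superchar_one hP, ncard_leftOrbit_add_coRep hP hlam, Nat.cast_pow]
    refine ⟨h1, by rw [h1, ncard_coadjL_eq_ncard_coadjR hlam], ?_⟩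
    have hq : (Nat.card F : ℂ) ≠ 0 := Nat.cast_ne_zero.2 Nat.card_pos.ne'
    rw [pairSuperchar, patternInner_superchar_self hP hθ, ncard_leftOrbit_add_coRep hP hlam,
      ncard_biorbit_add_coRep hP hlam, Nat.cast_pow, Nat.cast_pow,
      div_eq_iff (pow_ne_zero _ hq), ← pow_mul, ← pow_add]
    congr 1
    -- The exponent identity `2|L| = |L ∩ R| + |L ∪ R|`, which uses `|L| = |R|`.
    have := Set.ncard_union_add_ncard_inter (coadjL P lam) (coadjR P lam)
    rw [← ncard_coadjL_eq_ncard_coadjR hlam] at this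
    rw [coadj]
    omega
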